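/- **Setting.** $\mathbb R^q$ ($q\ge 1$) carries the $\ell_1$ norm $\|\cdot\|$ with closed unit ball $B_1(0)$; $\operatorname{cone}A$ is the convex conic hull ($\operatorname{cone}\emptyset=\{0\}$), $A^+=\{z: z^{\mathsf T}y\ge 0\ \forall y\in A\}$, and $A_\infty=\{d: y+\alpha d\in A\ \forall y\in A,\ \alpha\ge 0\}$. Consider the problem (P) minimize $\Gamma(x)$ with respect to $\le_C$ subject to $x\in\mathcal X$, where $\mathcal X\subseteq\mathbb R^n$ is closed and convex with nonempty interior, $C\subseteq\mathbb R^q$ is a closed, convex, non-trivial, pointed, solid, polyhedral cone, and $\Gamma:\mathcal X\to\mathbb R^q$ is continuous and $C$-convex. Its upper image is $\mathcal P=\operatorname{cl}(\Gamma(\mathcal X)+C)$. Fix $c\in\operatorname{int}C$ with $\|c\|=1$, a nonsingular $T\in\mathbb R^{q\times q}$ with last column $c$, a finite set $R$ with $\operatorname{cone}R=C$ and $\|d\|=1$ for $d\in R$, a finite set $R^*$ with $\operatorname{cone}R^*=C^+$ and $c^{\mathsf T}z=1$ for $z\in R^*$, and tolerances $\varepsilon,\delta>0$. Scalarizations: $(P_1(w))$: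 minimize $w^{\mathsf T}\Gamma(x)$ over $x\in\mathcal X$. For an ordering cone $Q$ (either $C$ or $\operatorname{cone}\mathcal Y$), $(P_2^Q(v,d))$, $d\neq 0$: maximize $z$ subject to $x\in\mathcal X$, $z\in\mathbb R$, $v+zd-\Gamma(x)\in Q$; its dual $(D_2^Q(v,d))$: minimize $\sup_{x\in\mathcal X}\{-w^{\mathsf T}\Gamma(x)\}+w^{\mathsf T}v$ subject to $w^{\mathsf T}d=-1$, $w\in Q^+$. Write $H(w,x)=\{y: w^{\mathsf T}(y-\Gamma(x))\ge 0\}$. **Phase 1.** Start with $\mathcal Y_{In}=R$, $\hat C=\emptyset$, $\mathcal P_0=\mathbb R^q$, $\bar{\mathcal X}=\bar{\mathcal T}=\emptyset$; choose $x_0\in\mathcal X$ and put $v=\Gamma(x_0)+\sum_{d\in R}d$. (i) For every $z\in R^*$ solve $(P_1(z))$; if it has an optimal solution $x$, add $x$ to $\bar{\mathcal X}$ and $T^{\mathsf T}z$ to $\bar{\mathcal T}$, and replace $\mathcal P_0$ by $\mathcal P_0\cap H(z,x)$. If none of these problems is unbounded, set $\mathcal Y_{Out}=R$ and end Phase 1.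 (ii) Otherwise, for every $d\in -R$ solve $(P_2^C(v,d))$ and $(D_2^C(v,d))$. If the former is unbounded, add $d$ to $\mathcal Y_{In}$; if they have optimal solutions $(x,z)$ and $w$, add $x$ to $\bar{\mathcal X}$ and $T^{\mathsf T}w/(c^{\mathsf T}w)$ to $\bar{\mathcal T}$, and replace $\mathcal P_0$ by $\mathcal P_0\cap H(w,x)$. Then set $\mathcal Y_{Out}=\operatorname{vert}((\mathcal P_0)_\infty\cap B_1(0))\setminus\{0\}$. (iii) While $\mathcal Y_{Out}\setminus(\mathcal Y_{In}\cup\hat C)\ne\emptyset$, take $d$ in this set and $\tilde r\in\mathcal Y_{In}$ nearest to $d$. If $\|d-\tilde r\|\le\delta$, add $d$ to $\hat C$. Otherwise choose $\lambda\in(0,1)$ with $e=\lambda d+(1-\lambda)\tilde r\neq 0$: if $(P_2^C(v,e))$ is unbounded, add $e/\|e\|$ to $\mathcal Y_{In}$; if $(P_2^C(v,e))$, $(D_2^C(v,e))$ have optimal solutions, update $\bar{\mathcal X},\bar{\mathcal T},\mathcal P_0$ as in (ii) and recompute $\mathcal Y_{Out}$. **Phase 2** (iterations on the problem (P') obtained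 from (P) by replacing $C$ with $\operatorname{cone}\mathcal Y_{Out}$). Set $k=0$. Repeat: let $M=\mathbb R^q$ and compute a V-representation $\mathcal P_k=\operatorname{conv}V+\operatorname{cone}D$, with $V$ finite and nonempty and $D$ a finite set of nonzero directions (if $\mathcal P_k$ contains no line, $V$ may be its set of vertices). For every $v\in V$ compute optimal solutions $(x,z)$ of $(P_2^{\operatorname{cone}\mathcal Y_{Out}}(v,-c))$ and $w$ of $(D_2^{\operatorname{cone}\mathcal Y_{Out}}(v,-c))$, add $x$ to $\bar{\mathcal X}$ and $T^{\mathsf T}w$ to $\bar{\mathcal T}$, and, if $-z>\varepsilon$, replace $M$ by $M\cap H(w,x)$. If $M\ne\mathbb R^q$, set $\mathcal P_{k+1}=\mathcal P_k\cap M$, increase $k$ by one and repeat; otherwise stop and output $\bar{\mathcal X},\mathcal Y_{Out},\bar{\mathcal T}$. The algorithm *terminates* if all loops end after finitely many steps and every scalarization that is not found to be unbounded is solved by optimal solutions as prescribed. **Geometric dual.** Let $K=\mathbb R_+e^q$, $w(t)=((t_1,\dots,t_{q-1},1)T^{-1})^{\mathsf T}$ and $D^*(t)=(t_1,\dots,t_{q-1},\inf_{x\in\mathcal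 X}w(t)^{\mathsf T}\Gamma(x))^{\mathsf T}\in\mathbb R^{q-1}\times[-\infty,\infty]$. The geometric dual (D) is: maximize $D^*(t)$ with respect to $\le_K$ subject to $w(t)\in C^+$. For a set $\mathcal Y$, the modified dual (D') has the constraint $w(t)\in(\operatorname{cone}\mathcal Y)^+$ instead; let $\mathcal T'$ be its feasible set and $\mathcal D'=D^*(\mathcal T')-K$. A finite $\varepsilon$-solution of (D') is a finite set $\bar{\mathcal T}\subseteq\mathcal T'$ such that $D^*(t)$ is a $K$-maximal element of $D^*(\mathcal T')$ for all $t\in\bar{\mathcal T}$ and $\operatorname{conv}D^*(\bar{\mathcal T})-K+\varepsilon\{e^q\}\supseteq\mathcal D'$. A pair $(\bar{\mathcal T},\mathcal Y)$ is a finite $(\varepsilon,\delta)$-solution of (D) if $\mathcal Y$ is finite, $\mathcal P_\infty\subseteq\operatorname{cone}\mathcal Y$, the Hausdorff distance of $\mathcal P_\infty\cap B_1(0)$ and $\operatorname{cone}\mathcal Y\cap B_1(0)$ is at most $\delta$, and $\bar{\mathcal T}$ is a finite $\varepsilon$-solution of (D'). **Theorem.** If the algorithm terminates with output $\bar{\mathcal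 X},\mathcal Y_{Out},\bar{\mathcal T}$, then $(\bar{\mathcal T},\mathcal Y_{Out})$ is a finite $(\varepsilon,\delta)$-solution of (D). -/

import Mathlib

open scoped Pointwise Matrix

noncomputable section

namespace CVO

/-! ### Finite-dimensional preliminaries -/

/-- `ℝ^q` with the `ℓ₁` norm. -/
abbrev Vec (q : ℕ) : Type := PiLp 1 (fun _ : Fin q => ℝ)

/-- The scalar product `wᵀ y`. -/
def dot {q : ℕ} (w y : Vec q) : ℝ := ∑ i, w i * y i

/-- Convex conic hull, with `cone ∅ = {0}`. -/
def cone {q : ℕ} (A : Set (Vec q)) : Set (Vec q) :=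
  (PointedCone.hull ℝ A : Set (Vec q))

/-- Positive dual cone `A⁺`. -/
def dualCone {q : ℕ} (A : Set (Vec q)) : Set (Vec q) :=
  {z | ∀ y ∈ A, 0 ≤ dot z y}

/-- Recession cone `A_∞`. -/
def recessionCone {q : ℕ} (A : Set (Vec q)) : Set (Vec q) :=
  {d | ∀ y ∈ A, ∀ α : ℝ, 0 ≤ α → y + α • d ∈ A}

/-- The half-space `{y | wᵀ (y - a) ≥ 0}`. -/
def halfspace {q : ℕ} (w a : Vec q) : Set (Vec q) :=
  {y | 0 ≤ dot w (y - a)}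

/-- Polyhedral convex sets, through an H-representation. -/
def IsPolyhedral {q : ℕ} (A : Set (Vec q)) : Prop :=
  ∃ H : Finset (Vec q × ℝ), (∀ h ∈ H, h.1 ≠ 0) ∧ A = {y | ∀ h ∈ H, h.2 ≤ dot h.1 y}

/-- `V` is the set of points (vertices) of a V-representation of `A`:
`A = conv V + cone D`, with `V` finite and nonempty and `D` a finite set of nonzero directions.
For a polyhedron that contains no line, the set of its extreme points is such a `V`; a polyhedron
that contains a line has no extreme points, but still has such representations. -/
def IsVRepPoints {q : ℕ} (A : Set (Vec q)) (V : Finset (Vec q)) : Prop :=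
  V.Nonempty ∧ ∃ D : Finset (Vec q), (∀ k ∈ D, k ≠ 0) ∧
    A = convexHull ℝ (V : Set (Vec q)) + cone (D : Set (Vec q))

/-- `vert (A_∞ ∩ B₁(0)) \ {0}`; the vertices of a polytope are its extreme points. -/
def outerDirections {q : ℕ} (A : Set (Vec q)) : Set (Vec q) :=
  Set.extremePoints ℝ (recessionCone A ∩ Metric.closedBall 0 1) \ {0}

/-! ### Convex vector optimization problems -/

/-- The data of a vector optimization problem: minimize `Γ x` with respect to `≤_C` subject to
`x ∈ X`. Only the values of `Γ` on `X` matter. -/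
structure CVOP (n q : ℕ) where
  X : Set (Fin n → ℝ)
  Γ : (Fin n → ℝ) → Vec q
  C : Set (Vec q)

namespace CVOP

variable {n q : ℕ}

/-- Closed feasible set with interior points; closed, convex, non-trivial, pointed, solid and
polyhedral ordering cone; continuous `C`-convex objective. -/
structure StandingAssumption (P : CVOP n q) : Prop where
  X_closed : IsClosed P.X
  X_convex : Convex ℝ P.X
  X_interior : (interior P.X).Nonempty
  C_closed : IsClosed P.C
  C_cone : ∀ y ∈ P.C, ∀ α : ℝ, 0 < α → α • y ∈ P.C
  C_add : ∀ y ∈ P.C, ∀ y' ∈ P.C, y + y' ∈ P.C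
  C_ne_zero : {0} ⊂ P.C
  C_ne_univ : P.C ⊂ Set.univ
  C_pointed : ∀ y ∈ P.C, -y ∈ P.C → y = 0
  C_solid : (interior P.C).Nonempty
  C_polyhedral : IsPolyhedral P.C
  Γ_continuous : ContinuousOn P.Γ P.X
  Γ_convex : ∀ x ∈ P.X, ∀ y ∈ P.X, ∀ α : ℝ, 0 ≤ α → α ≤ 1 →
    α • P.Γ x + (1 - α) • P.Γ y - P.Γ (α • x + (1 - α) • y) ∈ P.C

/-- Upper image `cl (Γ(X) + C)`. -/
def upperImage (P : CVOP n q) : Set (Vec q) := closure (P.Γ '' P.X + P.C)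

/-- The same problem with the ordering cone replaced by `cone Y`. -/
def withCone (P : CVOP n q) (Y : Set (Vec q)) : CVOP n q := { P with C := cone Y }

/-- `Y` is a `δ`-outer approximation of `𝒫_∞`. (Both sets in the Hausdorff distance are bounded
and contain `0`.) -/
def IsOuterApprox (P : CVOP n q) (δ : ℝ) (Y : Set (Vec q)) : Prop :=
  recessionCone P.upperImage ⊆ cone Y ∧
  Metric.hausdorffDist (recessionCone P.upperImage ∩ Metric.closedBall 0 1)
    (cone Y ∩ Metric.closedBall 0 1) ≤ δ

/-! ### Scalarizations -/

/-- `x` is an optimal solution of the weighted sum scalarization (P₁(w)):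
minimize `wᵀ Γ(x)` subject to `x ∈ X`. -/
def P1Optimal (P : CVOP n q) (w : Vec q) (x : Fin n → ℝ) : Prop :=
  x ∈ P.X ∧ ∀ x' ∈ P.X, dot w (P.Γ x) ≤ dot w (P.Γ x')

def P1Unbounded (P : CVOP n q) (w : Vec q) : Prop :=
  ¬ BddBelow ((fun x => dot w (P.Γ x)) '' P.X)

/-- Feasible points of the Pascoletti-Serafini scalarization (P₂(v,d)):
maximize `z` subject to `x ∈ X`, `Γ(x) - v - z d ≤_C 0`. -/
def P2Feasible (P : CVOP n q) (v d : Vec q) (x : Fin n → ℝ) (z : ℝ) : Prop :=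
  x ∈ P.X ∧ v + z • d - P.Γ x ∈ P.C

def P2Optimal (P : CVOP n q) (v d : Vec q) (x : Fin n → ℝ) (z : ℝ) : Prop :=
  P.P2Feasible v d x z ∧ ∀ x' z', P.P2Feasible v d x' z' → z' ≤ z

def P2Unbounded (P : CVOP n q) (v d : Vec q) : Prop :=
  ¬ BddAbove {z : ℝ | ∃ x, P.P2Feasible v d x z}

/-- Feasible points of the Lagrangian dual (D₂(v,d)). -/
def D2Feasible (P : CVOP n q) (d w : Vec q) : Prop :=
  dot w d = -1 ∧ w ∈ dualCone P.C

/-- Objective `sup_{x ∈ X} (-wᵀ Γ(x)) + wᵀ v` of (D₂(v,d)). -/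
def D2Value (P : CVOP n q) (v w : Vec q) : EReal :=
  (⨆ x ∈ P.X, ((-(dot w (P.Γ x)) : ℝ) : EReal)) + ((dot w v : ℝ) : EReal)

def D2Optimal (P : CVOP n q) (v d w : Vec q) : Prop :=
  P.D2Feasible d w ∧ ∀ w', P.D2Feasible d w' → P.D2Value v w ≤ P.D2Value v w'

end CVOP

/-! ### Loops -/

/-- Sequential execution of a nondeterministic step for every element of a list. -/
inductive ForEach {α σ : Type} (step : α → σ → σ → Prop) : List α → σ → σ → Prop
  | nil (s : σ) : ForEach step [] s s
  | cons {a : α} {l : List α} {s s' s'' : σ} :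
      step a s s' → ForEach step l s' s'' → ForEach step (a :: l) s s''

/-- `l` lists every element of `A` exactly once. -/
def Enumerates {α : Type} (l : List α) (A : Finset α) : Prop :=
  l.Nodup ∧ ∀ a, a ∈ l ↔ a ∈ A

/-! ### First phase: outer approximation of the recession cone -/

/-- Variables of the first phase. -/
structure State1 (n q : ℕ) where
  YIn : Set (Vec q)
  Chat : Set (Vec q)
  YOut : Set (Vec q)
  P0 : Set (Vec q)
  Xbar : Set (Fin n → ℝ)
  Tbar : Set (Vec q)
  b : Bool

/-- `Tᵀ w`. -/
def tmul {q : ℕ} (T : Matrix (Fin q) (Fin q) ℝ) (w : Vec q) : Vec q :=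
  WithLp.toLp 1 (Tᵀ *ᵥ w.ofLp)

/-- Input of the algorithms besides the problem: the direction `c`, generating directions `R` of
`C` and `Rs` of `C⁺`, and the matrix `T`. -/
structure Input (q : ℕ) where
  c : Vec q
  R : Finset (Vec q)
  Rs : Finset (Vec q)
  T : Matrix (Fin q) (Fin q) ℝ

structure Input.Valid {n m : ℕ} (I : Input (m + 1)) (P : CVOP n (m + 1)) : Prop where
  c_interior : I.c ∈ interior P.C
  c_norm : ‖I.c‖ = 1
  R_generates : cone (I.R : Set (Vec (m + 1))) = P.C
  R_norm : ∀ d ∈ I.R, ‖d‖ = 1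
  Rs_generates : cone (I.Rs : Set (Vec (m + 1))) = dualCone P.C
  Rs_norm : ∀ z ∈ I.Rs, dot I.c z = 1
  T_nonsingular : IsUnit I.T.det
  T_last : ∀ i, I.T i (Fin.last m) = I.c i

section Phase1

variable {n q : ℕ} (P : CVOP n q) (I : Input q)

/-- `Y_In = R`, `Ĉ = ∅`, `P₀ = ℝ^q`, `X̄ = ∅`, `T̄ = ∅`, `b = 1`. -/
def initState : State1 n q where
  YIn := I.R
  Chat := ∅
  YOut := ∅
  P0 := Set.univ
  Xbar := ∅
  Tbar := ∅
  b := true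

/-- Boundedness check for one `z ∈ R*`. -/
def boundednessStep (z : Vec q) (s s' : State1 n q) : Prop :=
  (P.P1Unbounded z ∧ s' = { s with b := false }) ∨
  (∃ x, P.P1Optimal z x ∧
    s' = { s with
      Xbar := s.Xbar ∪ {x}
      Tbar := s.Tbar ∪ {tmul I.T z}
      P0 := s.P0 ∩ halfspace z (P.Γ x) })

/-- Check for lineality directions, for one `d ∈ -R`. -/
def linealityStep (v d : Vec q) (s s' : State1 n q) : Prop :=
  (P.P2Unbounded v d ∧ s' = { s with YIn := s.YIn ∪ {d} }) ∨
  (∃ x z w, P.P2Optimal v d x z ∧ P.D2Optimal v d w ∧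
    s' = { s with
      Xbar := s.Xbar ∪ {x}
      Tbar := s.Tbar ∪ {tmul I.T ((dot I.c w)⁻¹ • w)}
      P0 := s.P0 ∩ halfspace w (P.Γ x) })

/-- Treatment of the direction `e = λ d + (1 - λ) r̃` in the main loop. -/
def refineStep (v e : Vec q) (s s' : State1 n q) : Prop :=
  (P.P2Unbounded v e ∧ s' = { s with YIn := s.YIn ∪ {‖e‖⁻¹ • e} }) ∨
  (∃ x z w, P.P2Optimal v e x z ∧ P.D2Optimal v e w ∧
    s' = { s with
      Xbar := s.Xbar ∪ {x}
      Tbar := s.Tbar ∪ {tmul I.T ((dot I.c w)⁻¹ • w)}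
      P0 := s.P0 ∩ halfspace w (P.Γ x)
      YOut := outerDirections (s.P0 ∩ halfspace w (P.Γ x)) })

/-- One pass of the main loop. -/
def loopStep (δ : ℝ) (v : Vec q) (s s' : State1 n q) : Prop :=
  ∃ d ∈ s.YOut \ (s.YIn ∪ s.Chat), ∃ r ∈ s.YIn, (∀ r' ∈ s.YIn, ‖d - r‖ ≤ ‖d - r'‖) ∧
    ((‖d - r‖ ≤ δ ∧ s' = { s with Chat := s.Chat ∪ {d} }) ∨
     (δ < ‖d - r‖ ∧ ∃ l : ℝ, 0 < l ∧ l < 1 ∧ l • d + (1 - l) • r ≠ 0 ∧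
        refineStep P I v (l • d + (1 - l) • r) s s'))

/-- The first phase, run with tolerance `δ`, terminates with final values `out`. -/
def Phase1Terminates (δ : ℝ) (out : State1 n q) : Prop :=
  ∃ x₀ ∈ P.X, ∃ lz, Enumerates lz I.Rs ∧ ∃ s₃ : State1 n q,
    ForEach (boundednessStep P I) lz (initState I) s₃ ∧
    ((s₃.b = true ∧ out = { s₃ with YOut := (I.R : Set (Vec q)) }) ∨
     (s₃.b = false ∧ ∃ lr, Enumerates lr I.R ∧ ∃ s₅ : State1 n q,
        ForEach (linealityStep P I (P.Γ x₀ + ∑ d ∈ I.R, d)) (lr.map (fun r => -r)) s₃ s₅ ∧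
        Relation.ReflTransGen (loopStep P I δ (P.Γ x₀ + ∑ d ∈ I.R, d))
          { s₅ with YOut := outerDirections s₅.P0 } out ∧
        out.YOut \ (out.YIn ∪ out.Chat) = ∅))

end Phase1

/-! ### Second phase: primal algorithm -/

/-- Variables of the second phase; `Pk` is the current outer approximation. -/
structure State2 (n q : ℕ) where
  Pk : Set (Vec q)
  Xbar : Set (Fin n → ℝ)
  Tbar : Set (Vec q)
  M : Set (Vec q)

section Phase2

variable {n q : ℕ} (P : CVOP n q) (I : Input q)

/-- Treatment of one vertex `v`: the scalarizations of `P` in direction `-c` are solved; since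
(P₂) is a maximization problem, the distance from `v` to the upper image along `c` is `-z`. -/
def vertexStep (ε : ℝ) (v : Vec q) (s s' : State2 n q) : Prop :=
  ∃ x z w, P.P2Optimal v (-I.c) x z ∧ P.D2Optimal v (-I.c) w ∧
    ((ε < -z ∧ s' = { s with
        Xbar := s.Xbar ∪ {x}
        Tbar := s.Tbar ∪ {tmul I.T w}
        M := s.M ∩ halfspace w (P.Γ x) }) ∨
     (-z ≤ ε ∧ s' = { s with
        Xbar := s.Xbar ∪ {x}
        Tbar := s.Tbar ∪ {tmul I.T w} }))

/-- One pass of the while loop. -/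
def outerStep (ε : ℝ) (s s' : State2 n q) : Prop :=
  s.M ≠ Set.univ ∧ ∃ V : Finset (Vec q), IsVRepPoints s.Pk V ∧
    ∃ l, Enumerates l V ∧ ∃ s₁ : State2 n q,
      ForEach (vertexStep P I ε) l { s with M := Set.univ } s₁ ∧
      ((s₁.M ≠ Set.univ ∧ s' = { s₁ with Pk := s₁.Pk ∩ s₁.M }) ∨
       (s₁.M = Set.univ ∧ s' = s₁))

/-- The primal algorithm with tolerances `ε`, `δ` terminates with output `(X̄, Y_Out, T̄)`. The
second phase works on the modified problem, whose ordering cone is `cone Y_Out`. -/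
def PrimalAlgorithmTerminates (ε δ : ℝ) (Xbar : Set (Fin n → ℝ)) (YOut Tbar : Set (Vec q)) :
    Prop :=
  ∃ (s : State1 n q) (out : State2 n q), Phase1Terminates P I δ s ∧
    Relation.ReflTransGen (outerStep (P.withCone s.YOut) I ε)
      { Pk := s.P0, Xbar := s.Xbar, Tbar := s.Tbar, M := ∅ } out ∧
    out.M = Set.univ ∧ Xbar = out.Xbar ∧ YOut = s.YOut ∧ Tbar = out.Tbar

end Phase2

/-! ### Geometric dual problem -/

section Dual

variable {n m : ℕ}

/-- `w(t) = ((t₁, …, t_{q-1}, 1) T⁻¹)ᵀ`. -/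
def weight (T : Matrix (Fin (m + 1)) (Fin (m + 1)) ℝ) (t : Vec (m + 1)) : Vec (m + 1) :=
  WithLp.toLp 1 (Function.update t.ofLp (Fin.last m) 1 ᵥ* T⁻¹)

/-- `D*(t) = (t₁, …, t_{q-1}, inf_{x ∈ X} w(t)ᵀ Γ(x))`, with an extended real last entry. -/
def dualObjective (P : CVOP n (m + 1)) (T : Matrix (Fin (m + 1)) (Fin (m + 1)) ℝ)
    (t : Vec (m + 1)) : (Fin m → ℝ) × EReal :=
  (fun i => t i.castSucc, ⨅ x ∈ P.X, ((dot (weight T t) (P.Γ x) : ℝ) : EReal))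

/-- Feasible set `{t | w(t) ∈ C⁺}` of the geometric dual of `P`. -/
def dualFeasible (P : CVOP n (m + 1)) (T : Matrix (Fin (m + 1)) (Fin (m + 1)) ℝ) :
    Set (Vec (m + 1)) :=
  {t | weight T t ∈ dualCone P.C}

/-- The canonical embedding `ℝ^q → ℝ^{q-1} × [-∞, ∞]`. -/
def embed (y : Vec (m + 1)) : (Fin m → ℝ) × EReal :=
  (fun i => y i.castSucc, ((y (Fin.last m) : ℝ) : EReal))

/-- `e^q`. -/
def lastUnit (m : ℕ) : Vec (m + 1) := WithLp.toLp 1 (Pi.single (Fin.last m) 1)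

/-- `K = ℝ₊ e^q`. -/
def coneK (m : ℕ) : Set (Vec (m + 1)) := {y | ∃ k : ℝ, 0 ≤ k ∧ y = k • lastUnit m}

/-- `y` is a `K`-maximal element of `A`: `({y} + K \ {0}) ∩ A = ∅`. -/
def IsKMaximal (A : Set ((Fin m → ℝ) × EReal)) (y : (Fin m → ℝ) × EReal) : Prop :=
  y ∈ A ∧ ∀ k : ℝ, 0 < k → (y.1, y.2 + (k : EReal)) ∉ A

/-- Lower image `D*(𝒯) - K`. -/
def lowerImage (P : CVOP n (m + 1)) (T : Matrix (Fin (m + 1)) (Fin (m + 1)) ℝ) :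
    Set ((Fin m → ℝ) × EReal) :=
  {y | ∃ t ∈ dualFeasible P T, ∃ k : ℝ, 0 ≤ k ∧
    y = ((dualObjective P T t).1, (dualObjective P T t).2 - (k : EReal))}

/-- `Tbar` is a finite `ε`-solution of the geometric dual of `P`: finitely many feasible points
with `K`-maximal values and `conv D*(T̄) - K + ε {e^q} ⊇ 𝒟`. -/
def IsFiniteDualEpsSolution (P : CVOP n (m + 1)) (T : Matrix (Fin (m + 1)) (Fin (m + 1)) ℝ)
    (ε : ℝ) (Tbar : Set (Vec (m + 1))) : Prop :=
  Tbar.Finite ∧ Tbar ⊆ dualFeasible P T ∧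
  (∀ t ∈ Tbar, IsKMaximal (dualObjective P T '' dualFeasible P T) (dualObjective P T t)) ∧
  lowerImage P T ⊆
    embed '' (convexHull ℝ (embed ⁻¹' (dualObjective P T '' Tbar)) - coneK m + {ε • lastUnit m})

/-- `(Tbar, Y)` is a finite `(ε, δ)`-solution of the geometric dual of `P`: `Y` is a finite
`δ`-outer approximation of `𝒫_∞`, and `Tbar` is a finite `ε`-solution of the modified geometric
dual, whose feasible weights lie in `(cone Y)⁺`. -/
def IsFiniteDualSolution (P : CVOP n (m + 1)) (T : Matrix (Fin (m + 1)) (Fin (m + 1)) ℝ)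
    (ε δ : ℝ) (Tbar Y : Set (Vec (m + 1))) : Prop :=
  Y.Finite ∧ P.IsOuterApprox δ Y ∧ IsFiniteDualEpsSolution (P.withCone Y) T ε Tbar

end Dual

end CVO

end

/-!
Every optimal pair of the scalarizations (P₂), (D₂) yields, by strong duality, a hyperplane that
supports the upper image; normalized by `c`, its normal `w` is the weight of a dual point `Tᵀ w`
whose value `D*(Tᵀ w)` is finite and hence `K`-maximal. So all the half-spaces `W` used by the
algorithm are recorded in `T̄`. The first phase ends with a finite set `Y_Out` that generates the
recession cone of `P₀`, and the second phase with a polyhedron whose vertices are `ε`-close to the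
upper image along `c`. For every feasible `t` of the modified dual, the half-space with normal
`w(t)` that supports the upper image therefore contains this polyhedron after a shift by `ε`, and
linear programming duality bounds `D*(t) - ε` by a convex combination of the points that
correspond to `W`.
-/

namespace CVO

/-! ### The scalar product -/

section ScalarProduct

variable {q : ℕ}

theorem dot_comm (w y : Vec q) : dot w y = dot y w :=
  dotProduct_comm w.ofLp y.ofLp

theorem dot_add (w y y' : Vec q) : dot w (y + y') = dot w y + dot w y' :=
  dotProduct_add w.ofLp y.ofLp y'.ofLp

theorem add_dot (w w' y : Vec q) : dot (w + w') y = dot w y + dot w' y :=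
  add_dotProduct w.ofLp w'.ofLp y.ofLp

theorem dot_smul (a : ℝ) (w y : Vec q) : dot w (a • y) = a * dot w y :=
  dotProduct_smul a w.ofLp y.ofLp

theorem smul_dot (a : ℝ) (w y : Vec q) : dot (a • w) y = a * dot w y :=
  smul_dotProduct a w.ofLp y.ofLp

theorem dot_neg (w y : Vec q) : dot w (-y) = -dot w y :=
  dotProduct_neg w.ofLp y.ofLp

theorem neg_dot (w y : Vec q) : dot (-w) y = -dot w y :=
  neg_dotProduct w.ofLp y.ofLp

theorem dot_sub (w y y' : Vec q) : dot w (y - y') = dot w y - dot w y' :=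
  dotProduct_sub w.ofLp y.ofLp y'.ofLp

theorem dot_zero (w : Vec q) : dot w 0 = 0 :=
  dotProduct_zero w.ofLp

theorem zero_dot (y : Vec q) : dot 0 y = 0 :=
  zero_dotProduct y.ofLp

theorem dot_sum (w : Vec q) (R : Finset (Vec q)) : dot w (∑ d ∈ R, d) = ∑ d ∈ R, dot w d :=
  map_sum (AddMonoidHom.mk' (dot w) (dot_add w)) id R

theorem dot_self_pos {w : Vec q} (hw : w ≠ 0) : 0 < dot w w :=
  (dotProduct_self_star_nonneg w.ofLp).lt_of_ne' fun h =>
    hw ((WithLp.ofLp_eq_zero 1).1 (dotProduct_self_eq_zero.1 h))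

theorem continuous_dot (w : Vec q) : Continuous (dot w) := by
  unfold dot
  fun_prop

theorem isClosed_dot_ge (w : Vec q) (b : ℝ) : IsClosed {y | b ≤ dot w y} :=
  isClosed_le continuous_const (continuous_dot w)

theorem convex_dot_ge (w : Vec q) (b : ℝ) : Convex ℝ {y | b ≤ dot w y} :=
  convex_halfSpace_ge (IsLinearMap.mk (dot_add w) fun a y => dot_smul a w y) b

/-- The scalar product as a bilinear pairing, which gives access to `PointedCone.dual`. -/
def dotBilin (q : ℕ) : Vec q →ₗ[ℝ] Vec q →ₗ[ℝ] ℝ :=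
  LinearMap.mk₂ ℝ dot add_dot smul_dot dot_add dot_smul

theorem exists_eq_dot (f : Vec q →ₗ[ℝ] ℝ) : ∃ w : Vec q, ∀ y, f y = dot w y := by
  let g := f ∘ₗ (WithLp.linearEquiv 1 ℝ (Fin q → ℝ)).symm.toLinearMap
  refine ⟨WithLp.toLp 1 ((dotProductEquiv ℝ (Fin q)).symm g), fun y => ?_⟩
  exact (LinearMap.congr_fun ((dotProductEquiv ℝ (Fin q)).apply_symm_apply g) y.ofLp).symm

theorem halfspace_eq (w a : Vec q) : halfspace w a = {y | dot w a ≤ dot w y} := by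
  ext y
  simp only [halfspace, dot_sub, sub_nonneg, Set.mem_ofPred_eq]

theorem halfspace_smul {a : ℝ} (ha : 0 < a) (w y : Vec q) :
    halfspace (a • w) y = halfspace w y := by
  ext y'
  simp only [halfspace, smul_dot, mul_nonneg_iff_of_pos_left ha, Set.mem_ofPred_eq]

theorem halfspace_ne_univ {w : Vec q} (hw : w ≠ 0) (a : Vec q) :
    halfspace w a ≠ Set.univ := by
  refine (Set.ne_univ_iff_exists_notMem _).2 ⟨a - w, ?_⟩
  simpa only [halfspace, Set.mem_ofPred_eq, sub_sub_cancel_left, dot_neg, neg_nonneg, not_le]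
    using dot_self_pos hw

end ScalarProduct

/-! ### Convex cones and dual cones -/

section Cones

variable {q : ℕ} {A B C : Set (Vec q)}

theorem subset_cone (A : Set (Vec q)) : A ⊆ cone A :=
  PointedCone.subset_hull

theorem convex_cone (A : Set (Vec q)) : Convex ℝ (cone A) :=
  PointedCone.convex _

theorem zero_mem_cone (A : Set (Vec q)) : (0 : Vec q) ∈ cone A :=
  (PointedCone.hull ℝ A).zero_mem

theorem add_mem_cone {y y' : Vec q} (hy : y ∈ cone A) (hy' : y' ∈ cone A) : y + y' ∈ cone A :=
  (PointedCone.hull ℝ A).add_mem hy hy'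

theorem smul_mem_cone {y : Vec q} (hy : y ∈ cone A) {a : ℝ} (ha : 0 ≤ a) : a • y ∈ cone A :=
  PointedCone.smul_mem _ ha hy

theorem cone_coe (K : PointedCone ℝ (Vec q)) : cone (K : Set (Vec q)) = K :=
  congrArg _ (Submodule.span_eq K)

theorem cone_cone (A : Set (Vec q)) : cone (cone A) = cone A :=
  cone_coe _

theorem cone_eq_self (hzero : (0 : Vec q) ∈ A) (hadd : ∀ y ∈ A, ∀ y' ∈ A, y + y' ∈ A)
    (hsmul : ∀ y ∈ A, ∀ a : ℝ, 0 ≤ a → a • y ∈ A) : cone A = A :=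
  cone_coe
    { carrier := A
      zero_mem' := hzero
      add_mem' := fun hy hy' => hadd _ hy _ hy'
      smul_mem' := fun a _ hy => hsmul _ hy a a.2 }

theorem cone_mono (h : A ⊆ B) : cone A ⊆ cone B :=
  Submodule.span_mono h

theorem cone_subset (hB : cone B = B) (h : A ⊆ B) : cone A ⊆ B :=
  (cone_mono h).trans hB.subset

theorem cone_sdiff_zero (A : Set (Vec q)) : cone (A \ {0}) = cone A :=
  congrArg SetLike.coe Submodule.span_sdiff_singleton_zero

theorem cone_convexHull (A : Set (Vec q)) : cone (convexHull ℝ A) = cone A :=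
  (cone_subset (cone_cone A) (convexHull_min (subset_cone A) (convex_cone A))).antisymm
    (cone_mono (subset_convexHull ℝ A))

theorem cone_inter_closedBall (hA : cone A = A) : cone (A ∩ Metric.closedBall 0 1) = A := by
  refine (cone_subset hA Set.inter_subset_left).antisymm fun y hy => ?_
  rw [← hA] at hy
  rcases eq_or_ne y 0 with rfl | hy0
  · exact zero_mem_cone _
  have hunit : ‖y‖⁻¹ • y ∈ A ∩ Metric.closedBall 0 1 :=
    ⟨hA ▸ smul_mem_cone hy (by positivity), inv_norm_smul_mem_unitClosedBall y⟩
  simpa only [smul_inv_smul₀ (norm_ne_zero_iff.2 hy0)] using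
    smul_mem_cone (subset_cone _ hunit) (norm_nonneg y)

theorem sum_mem_cone (R : Finset (Vec q)) : ∑ d ∈ R, d ∈ cone (R : Set (Vec q)) :=
  (PointedCone.hull ℝ (R : Set (Vec q))).sum_mem fun _ hd => subset_cone _ hd

theorem coe_dual_dotBilin (A : Set (Vec q)) :
    (PointedCone.dual (dotBilin q) A : Set (Vec q)) = dualCone A := by
  ext z
  exact forall₂_congr fun y _ => by rw [dot_comm]; rfl

theorem dualCone_cone (A : Set (Vec q)) : dualCone (cone A) = dualCone A := by
  rw [← coe_dual_dotBilin, ← coe_dual_dotBilin, cone, PointedCone.dual_hull]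

theorem cone_dualCone (A : Set (Vec q)) : cone (dualCone A) = dualCone A := by
  rw [← coe_dual_dotBilin, cone_coe]

theorem dualCone_anti (h : A ⊆ B) : dualCone B ⊆ dualCone A :=
  fun _ hz y hy => hz y (h hy)

theorem smul_mem_dualCone {w : Vec q} (hw : w ∈ dualCone A) {a : ℝ} (ha : 0 ≤ a) :
    a • w ∈ dualCone A :=
  cone_dualCone A ▸ smul_mem_cone (subset_cone _ hw) ha

theorem dualCone_dualCone (hC : cone C = C) (hcl : IsClosed C) : dualCone (dualCone C) = C := by
  let K : ProperCone ℝ (Vec q) := ⟨PointedCone.hull ℝ C, show IsClosed (cone C) by rwa [hC]⟩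
  have mem_K : ∀ y, y ∈ K ↔ y ∈ C := Set.ext_iff.1 hC
  refine Set.Subset.antisymm (fun y hy => ?_) fun y hy z hz => dot_comm y z ▸ hz y hy
  by_contra hyC
  obtain ⟨f, hfC, hfy⟩ := K.hyperplane_separation_point (mt (mem_K y).1 hyC)
  obtain ⟨w, hw⟩ := exists_eq_dot (f : Vec q →ₗ[ℝ] ℝ)
  have hwC : w ∈ dualCone C := fun k hk => hw k ▸ hfC k ((mem_K k).2 hk)
  exact hfy.not_ge ((hy w hwC).trans_eq ((dot_comm y w).trans (hw y).symm))

theorem exists_pos_add_smul_mem_interior {p : Vec q} (hp : p ∈ interior A) (d : Vec q) :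
    ∃ s : ℝ, 0 < s ∧ p + s • d ∈ interior A := by
  have hcont : Continuous fun s : ℝ => p + s • d := by fun_prop
  have hlim : Filter.Tendsto (fun s : ℝ => p + s • d) (nhdsWithin 0 (Set.Ioi 0)) (nhds p) := by
    simpa using (hcont.tendsto 0).mono_left nhdsWithin_le_nhds
  obtain ⟨s, hmem, hs⟩ := ((hlim.eventually (isOpen_interior.mem_nhds hp)).and
    self_mem_nhdsWithin).exists
  exact ⟨s, hs, hmem⟩

theorem exists_add_smul_mem_interior (hC : cone C = C) {c : Vec q} (hc : c ∈ interior C)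
    (a : Vec q) : ∃ t : ℝ, a + t • c ∈ interior C := by
  obtain ⟨s, hs, hmem⟩ := exists_pos_add_smul_mem_interior hc a
  have hscale : s⁻¹ • C ⊆ C := by
    rintro _ ⟨y, hy, rfl⟩
    exact hC ▸ smul_mem_cone (subset_cone C hy) (inv_nonneg.2 hs.le)
  refine ⟨s⁻¹, interior_mono hscale ?_⟩
  rw [interior_smul₀ (inv_ne_zero hs.ne')]
  refine ⟨_, hmem, ?_⟩
  simp only [smul_add, inv_smul_smul₀ hs.ne', add_comm]

theorem dot_pos_of_mem_interior {c w : Vec q} (hc : c ∈ interior C) (hw : w ∈ dualCone C)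
    (hw0 : w ≠ 0) : 0 < dot w c := by
  obtain ⟨s, hs, hmem⟩ := exists_pos_add_smul_mem_interior hc (-w)
  have hnonneg := hw _ (interior_subset hmem)
  rw [dot_add, dot_smul, dot_neg] at hnonneg
  linarith [mul_pos hs (dot_self_pos hw0)]

theorem exists_support (hA : Convex ℝ A) (hint : (interior A).Nonempty) {p : Vec q}
    (hp : p ∉ interior A) : ∃ w : Vec q, w ≠ 0 ∧ ∀ a ∈ A, dot w p ≤ dot w a := by
  obtain ⟨f, hf0, hf⟩ := geometric_hahn_banach_of_nonempty_interior_point hA hp hint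
  obtain ⟨w, hw⟩ := exists_eq_dot (f : Vec q →ₗ[ℝ] ℝ)
  replace hw : ∀ y, f y = dot w y := hw
  refine ⟨-w, neg_ne_zero.2 ?_, fun a ha => ?_⟩
  · rintro rfl
    exact hf0 (ContinuousLinearMap.ext fun y => (hw y).trans (zero_dot y))
  · simpa only [neg_dot, neg_le_neg_iff, ← hw] using hf a ha

theorem sum_mem_interior_cone {R : Finset (Vec q)}
    (hint : (interior (cone (R : Set (Vec q)))).Nonempty) :
    ∑ d ∈ R, d ∈ interior (cone (R : Set (Vec q))) := by
  by_contra hR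
  obtain ⟨w, hw0, hw⟩ := exists_support (convex_cone _) hint hR
  have hnonneg : ∀ d ∈ R, 0 ≤ dot w d := fun d hd => by
    simpa only [dot_add, le_add_iff_nonneg_right]
      using hw _ (add_mem_cone (sum_mem_cone R) (subset_cone _ hd))
  have hsum : ∑ d ∈ R, dot w d ≤ 0 := by
    simpa only [dot_zero, dot_sum] using hw 0 (zero_mem_cone _)
  have hzero : ∀ d ∈ R, dot w d = 0 :=
    (Finset.sum_eq_zero_iff_of_nonneg hnonneg).1 (hsum.antisymm (Finset.sum_nonneg hnonneg))
  have hdual : w ∈ dualCone (cone (R : Set (Vec q))) := by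
    rwa [dualCone_cone]
  have hdual' : -w ∈ dualCone (cone (R : Set (Vec q))) := by
    rw [dualCone_cone]
    exact fun d hd => by rw [neg_dot, hzero d hd, neg_zero]
  obtain ⟨c, hc⟩ := hint
  have hpos := dot_pos_of_mem_interior hc hdual hw0
  have hneg := hdual' c (interior_subset hc)
  rw [neg_dot] at hneg
  linarith

end Cones

/-! ### Recession cones -/

section RecessionCones

variable {q : ℕ} {A : Set (Vec q)}

theorem nonneg_of_forall_le_add_mul {a b s : ℝ} (h : ∀ t : ℝ, 0 ≤ t → b ≤ a + t * s) : 0 ≤ s := by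
  by_contra! hs
  have hba : b ≤ a := by simpa using h 0 le_rfl
  have hlt := h ((a - b + 1) / -s) (div_nonneg (by linarith) (by linarith))
  rw [div_neg, neg_mul, div_mul_cancel₀ _ hs.ne] at hlt
  linarith

theorem dot_nonneg_of_mem_recessionCone (hA : A.Nonempty) {w d : Vec q} {b : ℝ}
    (hb : ∀ y ∈ A, b ≤ dot w y) (hd : d ∈ recessionCone A) : 0 ≤ dot w d := by
  obtain ⟨y, hy⟩ := hA
  refine nonneg_of_forall_le_add_mul (a := dot w y) (b := b) fun t ht => ?_
  rw [← dot_smul, ← dot_add]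
  exact hb _ (hd y hy t ht)

theorem cone_recessionCone (A : Set (Vec q)) : cone (recessionCone A) = recessionCone A := by
  refine cone_eq_self (fun y hy α _ => ?_) (fun d hd d' hd' y hy α hα => ?_)
    fun d hd a ha y hy α hα => ?_
  · rwa [smul_zero, add_zero]
  · rw [smul_add, ← add_assoc]
    exact hd' _ (hd y hy α hα) α hα
  · rw [smul_smul]
    exact hd y hy _ (mul_nonneg hα ha)

theorem convex_recessionCone (A : Set (Vec q)) : Convex ℝ (recessionCone A) :=
  cone_recessionCone A ▸ convex_cone _

theorem smul_mem_recessionCone {d : Vec q} (hd : d ∈ recessionCone A) {a : ℝ} (ha : 0 ≤ a) :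
    a • d ∈ recessionCone A :=
  cone_recessionCone A ▸ smul_mem_cone (subset_cone _ hd) ha

theorem cone_subset_recessionCone_add (A D : Set (Vec q)) :
    cone D ⊆ recessionCone (A + cone D) := by
  rintro d hd _ ⟨a, ha, k, hk, rfl⟩ α hα
  exact ⟨a, ha, k + α • d, add_mem_cone hk (smul_mem_cone hd hα), (add_assoc a k _).symm⟩

theorem recessionCone_subset_recessionCone_closure (A : Set (Vec q)) :
    recessionCone A ⊆ recessionCone (closure A) := by
  intro d hd y hy α hα
  have hcont : Continuous fun y : Vec q => y + α • d := by fun_prop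
  exact map_mem_closure (f := fun y : Vec q => y + α • d) hcont hy fun a ha => hd a ha α hα

/-- The points `y + α • d + (α / z) • (v - y)` of the segments from `y` to `v + z • d` tend to
`y + α • d` as `z` grows. -/
theorem mem_recessionCone_of_not_bddAbove (hA : Convex ℝ A) (hcl : IsClosed A) {v d : Vec q}
    (h : ¬ BddAbove {z : ℝ | v + z • d ∈ A}) : d ∈ recessionCone A := by
  intro y hy α hα
  have hlim : Filter.Tendsto (fun z => y + α • d + (α / z) • (v - y)) Filter.atTop
      (nhds (y + α • d)) := by
    simpa using ((Filter.tendsto_id.const_div_atTop α).smul_const (v - y)).const_add (y + α • d)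
  have hfreq : ∃ᶠ z in Filter.atTop, y + α • d + (α / z) • (v - y) ∈ A := by
    refine Filter.frequently_atTop.2 fun N => ?_
    obtain ⟨z, hzA, hz⟩ := not_bddAbove_iff.1 h (max N (α + 1))
    have hαz : α < z := by linarith [le_max_right N (α + 1)]
    have hz0 : 0 < z := hα.trans_lt hαz
    refine ⟨z, (le_max_left _ _).trans hz.le, ?_⟩
    have hseg := hA hy hzA (sub_nonneg.2 ((div_le_one hz0).2 hαz.le)) (by positivity)
      (sub_add_cancel 1 (α / z))
    have hd : α • d = (α / z) • z • d := by rw [smul_smul, div_mul_cancel₀ _ hz0.ne']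
    convert hseg using 1
    rw [hd]
    module
  exact hcl.mem_of_frequently_of_tendsto hfreq hlim

end RecessionCones

/-! ### Polyhedra -/

section Polyhedra

variable {q : ℕ} {W W' : Set (Vec q × ℝ)}

/-- The solution set of the inequalities `h.2 ≤ h.1ᵀ y`, `h ∈ W`. -/
def polyhedron (W : Set (Vec q × ℝ)) : Set (Vec q) := {y | ∀ h ∈ W, h.2 ≤ dot h.1 y}

theorem polyhedron_eq_iInter (W : Set (Vec q × ℝ)) :
    polyhedron W = ⋂ h ∈ W, {y | h.2 ≤ dot h.1 y} := by
  ext y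
  simp only [polyhedron, Set.mem_ofPred_eq, Set.mem_iInter]

theorem isClosed_polyhedron (W : Set (Vec q × ℝ)) : IsClosed (polyhedron W) :=
  polyhedron_eq_iInter W ▸ isClosed_biInter fun h _ => isClosed_dot_ge h.1 h.2

theorem polyhedron_empty : polyhedron (∅ : Set (Vec q × ℝ)) = Set.univ :=
  Set.eq_univ_of_forall fun _ _ h => h.elim

theorem polyhedron_union (W W' : Set (Vec q × ℝ)) :
    polyhedron (W ∪ W') = polyhedron W ∩ polyhedron W' := by
  ext y
  simp only [polyhedron, Set.mem_inter_iff, Set.mem_ofPred_eq, Set.mem_union, or_imp, forall_and]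

theorem polyhedron_insert (h : Vec q × ℝ) (W : Set (Vec q × ℝ)) :
    polyhedron (insert h W) = {y | h.2 ≤ dot h.1 y} ∩ polyhedron W := by
  ext y
  exact Set.forall_mem_insert

theorem recessionCone_polyhedron (hne : (polyhedron W).Nonempty) :
    recessionCone (polyhedron W) = dualCone (Prod.fst '' W) := by
  ext d
  constructor
  · rintro hd _ ⟨h, hh, rfl⟩
    rw [dot_comm]
    exact dot_nonneg_of_mem_recessionCone hne (fun y hy => hy h hh) hd
  · intro hd y hy t ht h hh
    have hdot : 0 ≤ dot h.1 d := dot_comm d h.1 ▸ hd _ (Set.mem_image_of_mem _ hh)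
    rw [dot_add, dot_smul]
    exact (hy h hh).trans (le_add_of_nonneg_right (mul_nonneg ht hdot))

theorem dualCone_eq_polyhedron (A : Set (Vec q)) :
    dualCone A = polyhedron ((fun w => (w, 0)) '' A) := by
  ext d
  simp only [dualCone, polyhedron, Set.forall_mem_image, Set.mem_ofPred_eq, dot_comm d]

/-- Two extreme points with the same active inequalities coincide, because one of them lies on a
segment between the other and a third point of the polyhedron. -/
theorem finite_extremePoints_polyhedron (hW : W.Finite) :
    (Set.extremePoints ℝ (polyhedron W)).Finite := by
  refine Set.Finite.of_finite_image
    (f := fun y => {h ∈ W | dot h.1 y = h.2}) (hW.finite_subsets.subset ?_) ?_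
  · rintro _ ⟨y, -, rfl⟩
    exact Set.sep_subset _ _
  intro x hx y hy hxy
  have hactive : ∀ h ∈ W, dot h.1 x = h.2 → dot h.1 y = h.2 := fun h hh hhx =>
    ((Set.ext_iff.1 hxy h).1 ⟨hh, hhx⟩).2
  have hbeyond : ∀ᶠ s in nhdsWithin (0 : ℝ) (Set.Ioi 0), x + s • (x - y) ∈ polyhedron W := by
    refine hW.eventually_all.2 fun h hh => ?_
    rcases (hx.1 h hh).eq_or_lt with heq | hlt
    · refine Filter.Eventually.of_forall fun s => ?_
      rw [dot_add, dot_smul, dot_sub, hactive h hh heq.symm, ← heq, sub_self, mul_zero, add_zero]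
    · have hcont : Continuous fun s : ℝ => dot h.1 (x + s • (x - y)) :=
        (continuous_dot h.1).comp (by fun_prop)
      have hlim : Filter.Tendsto (fun s : ℝ => dot h.1 (x + s • (x - y)))
          (nhdsWithin 0 (Set.Ioi 0)) (nhds (dot h.1 x)) := by
        simpa using (hcont.tendsto 0).mono_left nhdsWithin_le_nhds
      exact (hlim.eventually (lt_mem_nhds hlt)).mono fun s hs => hs.le
  obtain ⟨s, hsW, hspos : 0 < s⟩ := (hbeyond.and self_mem_nhdsWithin).exists
  have hopen : x ∈ openSegment ℝ y (x + s • (x - y)) := by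
    refine ⟨s / (1 + s), 1 / (1 + s), by positivity, by positivity,
      by rw [← add_div, add_comm, div_self (by positivity)], ?_⟩
    match_scalars
    · field_simp
      ring
    · field_simp
  exact (hx.2 hy.1 hsW hopen).symm

theorem norm_le_iff_forall_signs (y : Vec q) (r : ℝ) :
    ‖y‖ ≤ r ↔ ∀ σ : Fin q → SignType, ∑ i, (σ i : ℝ) * y i ≤ r := by
  rw [PiLp.norm_eq_of_L1]
  constructor
  · intro h σ
    refine (Finset.sum_le_sum fun i _ => ?_).trans h
    rcases σ i with _ | _ | _ <;> simp [neg_le_abs, le_abs_self]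
  · intro h
    refine (Finset.sum_le_sum fun i _ => ?_).trans (h fun i => SignType.sign (y i))
    rw [sign_mul_self, Real.norm_eq_abs]

theorem exists_closedBall_eq_polyhedron (q : ℕ) :
    ∃ B : Set (Vec q × ℝ), B.Finite ∧ Metric.closedBall (0 : Vec q) 1 = polyhedron B := by
  refine ⟨Set.range fun σ : Fin q → SignType => (WithLp.toLp 1 fun i => -(σ i : ℝ), -1),
    Set.finite_range _, ?_⟩
  ext y
  rw [mem_closedBall_zero_iff, norm_le_iff_forall_signs]
  simp [polyhedron, dot]

theorem finite_extremePoints_recessionCone (hW : W.Finite) (hne : (polyhedron W).Nonempty) :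
    (Set.extremePoints ℝ (recessionCone (polyhedron W) ∩ Metric.closedBall 0 1)).Finite := by
  obtain ⟨B, hB, hball⟩ := exists_closedBall_eq_polyhedron q
  rw [hball, recessionCone_polyhedron hne, dualCone_eq_polyhedron, ← polyhedron_union]
  exact finite_extremePoints_polyhedron (((hW.image _).image _).union hB)

theorem convexHull_extremePoints_recessionCone (hW : W.Finite) (hne : (polyhedron W).Nonempty) :
    convexHull ℝ (Set.extremePoints ℝ (recessionCone (polyhedron W) ∩ Metric.closedBall 0 1)) =
      recessionCone (polyhedron W) ∩ Metric.closedBall 0 1 := by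
  have hcl : IsClosed (recessionCone (polyhedron W)) := by
    rw [recessionCone_polyhedron hne, dualCone_eq_polyhedron]
    exact isClosed_polyhedron _
  rw [← ((finite_extremePoints_recessionCone hW hne).isClosed_convexHull ℝ).closure_eq]
  exact closure_convexHull_extremePoints ((isCompact_closedBall 0 1).inter_left hcl)
    ((convex_recessionCone _).inter (convex_closedBall 0 1))

theorem cone_outerDirections (hW : W.Finite) (hne : (polyhedron W).Nonempty) :
    cone (outerDirections (polyhedron W)) = recessionCone (polyhedron W) := by
  rw [outerDirections, cone_sdiff_zero, ← cone_convexHull,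
    convexHull_extremePoints_recessionCone hW hne, cone_inter_closedBall (cone_recessionCone _)]

end Polyhedra

/-! ### Linear programming duality -/

section LinearProgramming

variable {q : ℕ} {W : Set (Vec q × ℝ)} {w : Vec q} {b : ℝ}

/-- For `s = 0` the inequalities say that `y` is a recession direction, for `s > 0` that `s⁻¹ • y`
lies in the polyhedron. -/
theorem mul_le_dot_of_forall_polyhedron (hne : (polyhedron W).Nonempty)
    (hb : ∀ y ∈ polyhedron W, b ≤ dot w y) {s : ℝ} (hs : 0 ≤ s) {y : Vec q}
    (hy : ∀ h ∈ W, s * h.2 ≤ dot h.1 y) : s * b ≤ dot w y := by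
  rcases hs.eq_or_lt with rfl | hs
  · rw [zero_mul]
    refine dot_nonneg_of_mem_recessionCone hne hb ?_
    rw [recessionCone_polyhedron hne]
    rintro _ ⟨h, hh, rfl⟩
    simpa only [zero_mul, dot_comm h.1] using hy h hh
  · have hmem : s⁻¹ • y ∈ polyhedron W := fun h hh => by
      rw [dot_smul, le_inv_mul_iff₀ hs]
      exact hy h hh
    have hdot := hb _ hmem
    rwa [dot_smul, le_inv_mul_iff₀ hs] at hdot

/-- Linear programming duality. The normalization by `c` turns conic combinations of the
inequalities into convex ones. -/
theorem exists_mem_convexHull_of_forall_polyhedron (hW : W.Finite) (hne : (polyhedron W).Nonempty)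
    {c : Vec q} (hc : ∀ h ∈ W, dot c h.1 = 1) (hcw : dot c w = 1)
    (hb : ∀ y ∈ polyhedron W, b ≤ dot w y) : ∃ b', b ≤ b' ∧ (w, b') ∈ convexHull ℝ W := by
  by_contra! hnot
  have hdisj : Disjoint (convexHull ℝ W) ({w} ×ˢ Set.Ici b) := by
    rw [Set.disjoint_right]
    rintro ⟨_, r⟩ ⟨rfl, hr⟩
    exact hnot r hr
  obtain ⟨f, u, u', hfW, huu', hfw⟩ := geometric_hahn_banach_compact_closed
    (convex_convexHull ℝ W) (hW.isCompact_convexHull ℝ)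
    ((convex_singleton w).prod (convex_Ici b)) (isClosed_singleton.prod isClosed_Ici) hdisj
  obtain ⟨y, hy⟩ := exists_eq_dot ((f : Vec q × ℝ →ₗ[ℝ] ℝ) ∘ₗ LinearMap.inl ℝ (Vec q) ℝ)
  have hf : ∀ a r, f (a, r) = dot a y + r * f (0, 1) := fun a r => by
    have hsplit : ((a, r) : Vec q × ℝ) = (a, 0) + r • (0, 1) := by simp
    rw [hsplit, map_add, map_smul, show f (a, 0) = dot y a from hy a, dot_comm, smul_eq_mul]
  have hs : 0 ≤ f (0, 1) :=
    nonneg_of_forall_le_add_mul (a := dot w y + b * f (0, 1)) (b := u') fun t ht => by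
      have hray := hfw (w, b + t) ⟨rfl, le_add_of_nonneg_right ht⟩
      rw [hf] at hray
      linarith
  have hW_le : ∀ h ∈ W, f (0, 1) * h.2 ≤ dot h.1 (u • c - y) := fun h hh => by
    have hlt := hfW h (subset_convexHull ℝ W hh)
    rw [← Prod.mk.eta (p := h), hf] at hlt
    rw [dot_sub, dot_smul, dot_comm h.1 c, hc h hh]
    linarith
  have hle := mul_le_dot_of_forall_polyhedron hne hb hs hW_le
  have hlt := hfw (w, b) ⟨rfl, Set.self_mem_Ici⟩
  rw [hf] at hlt
  rw [dot_sub, dot_smul, dot_comm w c, hcw] at hle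
  linarith

end LinearProgramming

/-! ### Convex problems and their scalarizations -/

namespace CVOP

variable {n q : ℕ} {P : CVOP n q} {v d w c : Vec q} {x : Fin n → ℝ} {z : ℝ}

/-- Convexity of a vector optimization problem. This is the part of the standing assumption that
survives when the ordering cone is enlarged to `cone Y`, as the second phase does. -/
structure IsConvex (P : CVOP n q) : Prop where
  X_convex : Convex ℝ P.X
  cone_C : cone P.C = P.C
  Γ_convex : ∀ x ∈ P.X, ∀ y ∈ P.X, ∀ α : ℝ, 0 ≤ α → α ≤ 1 →
    α • P.Γ x + (1 - α) • P.Γ y - P.Γ (α • x + (1 - α) • y) ∈ P.C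

theorem StandingAssumption.isConvex (hP : P.StandingAssumption) : P.IsConvex where
  X_convex := hP.X_convex
  cone_C := cone_eq_self (hP.C_ne_zero.1 rfl) hP.C_add fun y hy a ha => by
    rcases ha.eq_or_lt with rfl | ha
    · exact zero_smul ℝ y ▸ hP.C_ne_zero.1 rfl
    · exact hP.C_cone y hy a ha
  Γ_convex := hP.Γ_convex

theorem IsConvex.withCone (hP : P.IsConvex) {Y : Set (Vec q)} (hY : P.C ⊆ cone Y) :
    (P.withCone Y).IsConvex where
  X_convex := hP.X_convex
  cone_C := cone_cone Y
  Γ_convex x hx y hy α hα hα' := hY (hP.Γ_convex x hx y hy α hα hα')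

theorem IsConvex.zero_mem (hP : P.IsConvex) : (0 : Vec q) ∈ P.C :=
  hP.cone_C ▸ zero_mem_cone P.C

theorem IsConvex.convex_image_add (hP : P.IsConvex) : Convex ℝ (P.Γ '' P.X + P.C) := by
  rw [← hP.cone_C]
  rintro _ ⟨_, ⟨x, hx, rfl⟩, k, hk, rfl⟩ _ ⟨_, ⟨x', hx', rfl⟩, k', hk', rfl⟩ s t hs ht hst
  obtain rfl : t = 1 - s := by linarith
  refine ⟨_, ⟨s • x + (1 - s) • x', hP.X_convex hx hx' hs ht hst, rfl⟩,
    (s • P.Γ x + (1 - s) • P.Γ x' - P.Γ (s • x + (1 - s) • x')) + (s • k + (1 - s) • k'),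
    add_mem_cone (subset_cone _ (hP.Γ_convex x hx x' hx' s hs (by linarith)))
      (convex_cone _ hk hk' hs ht hst), ?_⟩
  simp only [smul_add]
  abel

theorem IsConvex.convex_upperImage (hP : P.IsConvex) : Convex ℝ P.upperImage :=
  hP.convex_image_add.closure

theorem IsConvex.mem_upperImage (hP : P.IsConvex) (hx : x ∈ P.X) : P.Γ x ∈ P.upperImage :=
  subset_closure ⟨P.Γ x, Set.mem_image_of_mem P.Γ hx, 0, hP.zero_mem, add_zero _⟩

theorem IsConvex.C_subset_recessionCone (hP : P.IsConvex) :
    P.C ⊆ recessionCone P.upperImage := by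
  rw [upperImage, ← hP.cone_C]
  exact (cone_subset_recessionCone_add _ _).trans (recessionCone_subset_recessionCone_closure _)

theorem dot_le_of_mem_upperImage (hw : w ∈ dualCone P.C) {b : ℝ}
    (hb : ∀ x ∈ P.X, b ≤ dot w (P.Γ x)) {y : Vec q} (hy : y ∈ P.upperImage) : b ≤ dot w y := by
  refine closure_minimal ?_ (isClosed_dot_ge w b) hy
  rintro _ ⟨_, ⟨x, hx, rfl⟩, k, hk, rfl⟩
  rw [Set.mem_ofPred_eq, dot_add]
  linarith [hb x hx, hw k hk]

theorem exists_P2Feasible_iff :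
    (∃ x, P.P2Feasible v d x z) ↔ v + z • d ∈ P.Γ '' P.X + P.C := by
  constructor
  · rintro ⟨x, hx, hz⟩
    exact ⟨P.Γ x, Set.mem_image_of_mem P.Γ hx, _, hz, add_sub_cancel _ _⟩
  · rintro ⟨_, ⟨x, hx, rfl⟩, k, hk, hsum : P.Γ x + k = v + z • d⟩
    exact ⟨x, hx, by rwa [← hsum, add_sub_cancel_left]⟩

theorem IsConvex.mem_recessionCone_of_P2Unbounded (hP : P.IsConvex) (h : P.P2Unbounded v d) :
    d ∈ recessionCone P.upperImage := by
  have hsub : {z | ∃ x, P.P2Feasible v d x z} ⊆ {z | v + z • d ∈ P.upperImage} :=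
    fun _ hz => subset_closure (exists_P2Feasible_iff.1 hz)
  exact mem_recessionCone_of_not_bddAbove hP.convex_upperImage isClosed_closure fun hbdd =>
    h (hbdd.mono hsub)

theorem P2Optimal.notMem_interior (hx : P.P2Optimal v d x z) :
    v + z • d ∉ interior (P.Γ '' P.X + P.C) := by
  intro hint
  obtain ⟨s, hs, hmem⟩ := exists_pos_add_smul_mem_interior hint d
  rw [add_assoc, ← add_smul] at hmem
  obtain ⟨x', hx'⟩ := exists_P2Feasible_iff.2 (interior_subset hmem)
  linarith [hx.2 x' _ hx']

theorem IsConvex.exists_support_image_add (hP : P.IsConvex) (hX : P.X.Nonempty)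
    (hC : (interior P.C).Nonempty) {p : Vec q} (hp : p ∉ interior (P.Γ '' P.X + P.C)) :
    ∃ w ∈ dualCone P.C, w ≠ 0 ∧ ∀ x ∈ P.X, dot w p ≤ dot w (P.Γ x) := by
  have hint : (interior (P.Γ '' P.X + P.C)).Nonempty :=
    ((hX.image P.Γ).add hC).mono subset_interior_add_right
  obtain ⟨w, hw0, hw⟩ := exists_support hP.convex_image_add hint hp
  have hadd : ∀ x ∈ P.X, ∀ k ∈ P.C, dot w p ≤ dot w (P.Γ x) + dot w k := fun x hx k hk =>
    dot_add w (P.Γ x) k ▸ hw _ (Set.add_mem_add (Set.mem_image_of_mem P.Γ hx) hk)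
  refine ⟨w, fun k hk => ?_, hw0, fun x hx => ?_⟩
  · obtain ⟨x, hx⟩ := hX
    refine nonneg_of_forall_le_add_mul (a := dot w (P.Γ x)) (b := dot w p) fun t ht => ?_
    rw [← dot_smul]
    exact hadd x hx _ (hP.cone_C ▸ smul_mem_cone (subset_cone _ hk) ht)
  · simpa only [dot_zero, add_zero] using hadd x hx 0 hP.zero_mem

/-- Slater's condition for the Pascoletti-Serafini scalarization: it has a feasible point with
slack in the interior of the ordering cone. -/
def P2Slater (P : CVOP n q) (v d : Vec q) : Prop :=
  ∃ x ∈ P.X, ∃ z : ℝ, v + z • d - P.Γ x ∈ interior P.C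

theorem IsConvex.p2Slater_neg (hP : P.IsConvex) (hX : P.X.Nonempty) (hc : c ∈ interior P.C)
    (v : Vec q) : P.P2Slater v (-c) := by
  obtain ⟨x, hx⟩ := hX
  obtain ⟨t, ht⟩ := exists_add_smul_mem_interior hP.cone_C hc (v - P.Γ x)
  refine ⟨x, hx, -t, ?_⟩
  rwa [neg_smul_neg, add_sub_right_comm]

theorem p2Slater_add_sum {R : Finset (Vec q)} (hR : cone (R : Set (Vec q)) = P.C)
    (hC : (interior P.C).Nonempty) (hx : x ∈ P.X) (d : Vec q) :
    P.P2Slater (P.Γ x + ∑ r ∈ R, r) d := by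
  refine ⟨x, hx, 0, ?_⟩
  rw [zero_smul, add_zero, add_sub_cancel_left, ← hR]
  exact sum_mem_interior_cone (hR ▸ hC)

theorem d2Value_le_iff :
    P.D2Value v w ≤ (z : EReal) ↔ ∀ x ∈ P.X, dot w v - z ≤ dot w (P.Γ x) := by
  rw [D2Value, ← EReal.le_sub_iff_add_le (.inl (EReal.coe_ne_bot _)) (.inl (EReal.coe_ne_top _)),
    ← EReal.coe_sub, iSup₂_le_iff]
  refine forall₂_congr fun x _ => ?_
  rw [EReal.coe_le_coe_iff, neg_le, neg_sub]

/-- Strong duality. The normal of a hyperplane that supports `Γ(X) + C` at `v + z d` becomes dual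
feasible after scaling, Slater's condition ensuring that it is not orthogonal to `d`. -/
theorem IsConvex.exists_d2Value_le (hP : P.IsConvex) (hslater : P.P2Slater v d)
    (hx : P.P2Optimal v d x z) : ∃ w, P.D2Feasible d w ∧ P.D2Value v w ≤ (z : EReal) := by
  obtain ⟨x₁, hx₁, z₁, hz₁⟩ := hslater
  obtain ⟨u, hudual, hu0, hu⟩ :=
    hP.exists_support_image_add ⟨x, hx.1.1⟩ ⟨_, hz₁⟩ hx.notMem_interior
  have hu_neg : dot u d < 0 := by
    have hpos := dot_pos_of_mem_interior hz₁ hudual hu0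
    have hz₁z := hx.2 x₁ z₁ ⟨hx₁, interior_subset hz₁⟩
    have hle := hu x₁ hx₁
    rw [dot_sub, dot_add, dot_smul] at hpos
    rw [dot_add, dot_smul] at hle
    nlinarith
  have hscale : 0 < (-dot u d)⁻¹ := inv_pos.2 (neg_pos.2 hu_neg)
  have hfeasible : P.D2Feasible d ((-dot u d)⁻¹ • u) :=
    ⟨by rw [smul_dot, inv_neg, neg_mul, inv_mul_cancel₀ hu_neg.ne],
      smul_mem_dualCone hudual hscale.le⟩
  refine ⟨_, hfeasible, d2Value_le_iff.2 fun a ha => ?_⟩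
  have hle := mul_le_mul_of_nonneg_left (hu a ha) hscale.le
  rwa [← smul_dot, ← smul_dot, dot_add, dot_smul, hfeasible.1, mul_neg_one, ← sub_eq_add_neg]
    at hle

theorem IsConvex.p1Optimal_of_optimal (hP : P.IsConvex) (hslater : P.P2Slater v d)
    (hx : P.P2Optimal v d x z) (hw : P.D2Optimal v d w) : P.P1Optimal w x := by
  refine ⟨hx.1.1, fun x' hx' => ?_⟩
  obtain ⟨u, hu, huz⟩ := hP.exists_d2Value_le hslater hx
  have hduality := d2Value_le_iff.1 ((hw.2 u hu).trans huz) x' hx'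
  have hslack := hw.1.2 _ hx.1.2
  rw [dot_sub, dot_add, dot_smul, hw.1.1] at hslack
  linarith

theorem D2Feasible.dot_pos (hw : P.D2Feasible d w) (hc : c ∈ interior P.C) : 0 < dot c w := by
  rw [dot_comm]
  refine dot_pos_of_mem_interior hc hw.2 ?_
  rintro rfl
  simpa only [zero_dot, zero_eq_neg, one_ne_zero] using hw.1

end CVOP

/-! ### Supporting inequalities -/

section Supports

namespace CVOP

variable {n q : ℕ} {P : CVOP n q} {c w : Vec q} {x : Fin n → ℝ} {W : Set (Vec q × ℝ)}

/-- The inequality `h.2 ≤ h.1ᵀ y` is normalized by `c`, valid on the upper image of `P`, and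
active at some point of `Γ(X)`. -/
structure IsSupport (P : CVOP n q) (c : Vec q) (h : Vec q × ℝ) : Prop where
  norm : dot c h.1 = 1
  mem_dualCone : h.1 ∈ dualCone P.C
  attained : ∃ x ∈ P.X, dot h.1 (P.Γ x) = h.2
  le : ∀ x ∈ P.X, h.2 ≤ dot h.1 (P.Γ x)

/-- The inequality that defines the half-space `H(w, x)`, normalized by `c`. -/
noncomputable def supportingInequality (P : CVOP n q) (c w : Vec q) (x : Fin n → ℝ) :
    Vec q × ℝ :=
  ((dot c w)⁻¹ • w, dot ((dot c w)⁻¹ • w) (P.Γ x))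

theorem isSupport_supportingInequality (hx : P.P1Optimal w x) (hw : w ∈ dualCone P.C)
    (hcw : 0 < dot c w) : P.IsSupport c (P.supportingInequality c w x) where
  norm := by rw [supportingInequality, dot_smul, inv_mul_cancel₀ hcw.ne']
  mem_dualCone := smul_mem_dualCone hw (inv_nonneg.2 hcw.le)
  attained := ⟨x, hx.1, rfl⟩
  le x' hx' := by
    simp only [supportingInequality, smul_dot]
    exact mul_le_mul_of_nonneg_left (hx.2 x' hx') (inv_nonneg.2 hcw.le)

theorem polyhedron_insert_supportingInequality (hcw : 0 < dot c w) (x : Fin n → ℝ)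
    (W : Set (Vec q × ℝ)) :
    polyhedron (insert (P.supportingInequality c w x) W) =
      polyhedron W ∩ halfspace w (P.Γ x) := by
  rw [polyhedron_insert, Set.inter_comm, ← halfspace_smul (inv_pos.2 hcw), halfspace_eq]
  rfl

theorem upperImage_subset_polyhedron (hW : ∀ h ∈ W, P.IsSupport c h) :
    P.upperImage ⊆ polyhedron W :=
  fun _ hy h hh => dot_le_of_mem_upperImage (hW h hh).mem_dualCone (hW h hh).le hy

theorem IsConvex.recessionCone_upperImage_subset (hP : P.IsConvex) (hx : x ∈ P.X)
    (hW : ∀ h ∈ W, P.IsSupport c h) :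
    recessionCone P.upperImage ⊆ recessionCone (polyhedron W) := by
  have hsub := upperImage_subset_polyhedron hW
  rw [recessionCone_polyhedron ⟨_, hsub (hP.mem_upperImage hx)⟩]
  rintro d hd _ ⟨h, hh, rfl⟩
  rw [dot_comm]
  exact dot_nonneg_of_mem_recessionCone ⟨_, hP.mem_upperImage hx⟩ (fun y hy => hsub hy h hh) hd

end CVOP

end Supports

/-! ### The geometric dual problem -/

section GeometricDual

variable {n m : ℕ} {T : Matrix (Fin (m + 1)) (Fin (m + 1)) ℝ} {c w : Vec (m + 1)}

theorem tmul_last (hc : ∀ i, T i (Fin.last m) = c i) (w : Vec (m + 1)) :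
    tmul T w (Fin.last m) = dot c w := by
  simp only [tmul, Matrix.mulVec, dotProduct, Matrix.transpose_apply, hc, dot]

theorem weight_tmul (hT : IsUnit T.det) (hc : ∀ i, T i (Fin.last m) = c i) (hw : dot c w = 1) :
    weight T (tmul T w) = w := by
  have hupdate : Function.update (tmul T w).ofLp (Fin.last m) 1 = Tᵀ *ᵥ w.ofLp := by
    rw [← hw, ← tmul_last hc w, Function.update_eq_self]
    rfl
  rw [weight, hupdate, Matrix.mulVec_transpose, Matrix.vecMul_vecMul,
    Matrix.mul_nonsing_inv T hT, Matrix.vecMul_one]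

theorem tmul_weight (hT : IsUnit T.det) (t : Vec (m + 1)) :
    tmul T (weight T t) = WithLp.toLp 1 (Function.update t.ofLp (Fin.last m) 1) := by
  rw [tmul, weight, Matrix.mulVec_transpose, Matrix.vecMul_vecMul, Matrix.nonsing_inv_mul T hT,
    Matrix.vecMul_one]

theorem dot_weight (hT : IsUnit T.det) (hc : ∀ i, T i (Fin.last m) = c i) (t : Vec (m + 1)) :
    dot c (weight T t) = 1 := by
  rw [← tmul_last hc, tmul_weight hT]
  exact Function.update_self ..

/-- The point of `ℝ^q` that geometric duality assigns to the inequality `h.2 ≤ h.1ᵀ y`: the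
vector `Tᵀ h.1` with its last coordinate replaced by `h.2`. -/
def dualPoint (T : Matrix (Fin (m + 1)) (Fin (m + 1)) ℝ) : Vec (m + 1) × ℝ →ₗ[ℝ] Vec (m + 1) where
  toFun h := WithLp.toLp 1 (Function.update (tmul T h.1).ofLp (Fin.last m) h.2)
  map_add' h h' := by
    ext i
    rcases eq_or_ne i (Fin.last m) with rfl | hi
    · simp
    · simp [hi, tmul, Matrix.mulVec_add]
  map_smul' a h := by
    ext i
    rcases eq_or_ne i (Fin.last m) with rfl | hi
    · simp
    · simp [hi, tmul, Matrix.mulVec_smul]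

theorem dualPoint_last (h : Vec (m + 1) × ℝ) : dualPoint T h (Fin.last m) = h.2 :=
  Function.update_self ..

theorem dualPoint_castSucc (h : Vec (m + 1) × ℝ) (i : Fin m) :
    dualPoint T h i.castSucc = tmul T h.1 i.castSucc :=
  Function.update_of_ne (Fin.castSucc_lt_last i).ne ..

theorem dualPoint_weight_castSucc (hT : IsUnit T.det) (t : Vec (m + 1)) (b : ℝ) (i : Fin m) :
    dualPoint T (weight T t, b) i.castSucc = t i.castSucc := by
  rw [dualPoint_castSucc, tmul_weight hT]
  exact Function.update_of_ne (Fin.castSucc_lt_last i).ne ..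

theorem mem_embed_image {S : Set (Vec (m + 1))} {y : Vec (m + 1)} (hy : y ∈ S) {r ε : ℝ}
    (hr : r ≤ y (Fin.last m) + ε) :
    ((fun i => y i.castSucc, (r : EReal)) : (Fin m → ℝ) × EReal) ∈
      embed '' (S - coneK m + {ε • lastUnit m}) := by
  refine ⟨y - (y (Fin.last m) + ε - r) • lastUnit m + ε • lastUnit m,
    Set.add_mem_add (Set.sub_mem_sub hy ⟨_, sub_nonneg.2 hr, rfl⟩) rfl, Prod.ext ?_ ?_⟩
  · funext i
    simp [embed, lastUnit]
  · refine EReal.coe_eq_coe_iff.2 ?_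
    simp only [lastUnit, PiLp.add_apply, PiLp.sub_apply, PiLp.smul_apply, Pi.single_eq_same,
      smul_eq_mul, mul_one]
    ring

theorem exists_iInf_eq_coe {α : Type*} {X : Set α} (hX : X.Nonempty) {f : α → ℝ} {b : ℝ}
    (hb : ∀ x ∈ X, b ≤ f x) :
    ∃ β : ℝ, ⨅ x ∈ X, (f x : EReal) = β ∧ ∀ x ∈ X, β ≤ f x := by
  obtain ⟨x₀, hx₀⟩ := hX
  have hbot : ⨅ x ∈ X, (f x : EReal) ≠ ⊥ :=
    ((EReal.bot_lt_coe b).trans_le (le_iInf₂ fun x hx => EReal.coe_le_coe_iff.2 (hb x hx))).ne'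
  have htop : ⨅ x ∈ X, (f x : EReal) ≠ ⊤ :=
    ((iInf₂_le x₀ hx₀).trans_lt (EReal.coe_lt_top _)).ne
  refine ⟨_, (EReal.coe_toReal htop hbot).symm, fun x hx => ?_⟩
  rw [← EReal.coe_le_coe_iff, EReal.coe_toReal htop hbot]
  exact iInf₂_le x hx

variable {P : CVOP n (m + 1)} {h : Vec (m + 1) × ℝ}

theorem CVOP.IsSupport.iInf_eq (hh : P.IsSupport c h) :
    ⨅ x ∈ P.X, ((dot h.1 (P.Γ x) : ℝ) : EReal) = h.2 := by
  obtain ⟨x, hx, hxe⟩ := hh.attained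
  refine le_antisymm ?_ (le_iInf₂ fun x hx => EReal.coe_le_coe_iff.2 (hh.le x hx))
  exact hxe ▸ iInf₂_le x hx

theorem dualObjective_tmul (hT : IsUnit T.det) (hc : ∀ i, T i (Fin.last m) = c i)
    (hh : P.IsSupport c h) : dualObjective P T (tmul T h.1) = embed (dualPoint T h) := by
  simp only [dualObjective, embed, weight_tmul hT hc hh.norm, hh.iInf_eq, dualPoint_last,
    dualPoint_castSucc]

theorem tmul_mem_dualFeasible (hT : IsUnit T.det) (hc : ∀ i, T i (Fin.last m) = c i)
    (hh : P.IsSupport c h) : tmul T h.1 ∈ dualFeasible P T := by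
  rw [dualFeasible, Set.mem_ofPred_eq, weight_tmul hT hc hh.norm]
  exact hh.mem_dualCone

theorem dualObjective_congr {t t' : Vec (m + 1)}
    (h : (fun i : Fin m => t i.castSucc) = fun i => t' i.castSucc) :
    dualObjective P T t = dualObjective P T t' := by
  have hupdate :
      Function.update t.ofLp (Fin.last m) 1 = Function.update t'.ofLp (Fin.last m) 1 := by
    ext i
    refine Fin.lastCases ?_ (fun j => ?_) i
    · simp only [Function.update_self]
    · simpa only [Function.update_of_ne (Fin.castSucc_lt_last j).ne] using congrFun h j
  rw [dualObjective, dualObjective, weight, weight, h, hupdate]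

/-- Points with the same first coordinates have the same value `D*`, so a finite value is
maximal with respect to `K`. -/
theorem isKMaximal_dualObjective (hT : IsUnit T.det) (hc : ∀ i, T i (Fin.last m) = c i)
    (hh : P.IsSupport c h) :
    IsKMaximal (dualObjective P T '' dualFeasible P T) (dualObjective P T (tmul T h.1)) := by
  refine ⟨Set.mem_image_of_mem _ (tmul_mem_dualFeasible hT hc hh), ?_⟩
  rintro k hk ⟨t, -, ht⟩
  have hsame : dualObjective P T t = dualObjective P T (tmul T h.1) :=
    dualObjective_congr (congrArg Prod.fst ht)
  have hlast := congrArg Prod.snd (hsame.symm.trans ht)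
  rw [dualObjective_tmul hT hc hh, embed, dualPoint_last, ← EReal.coe_add,
    EReal.coe_eq_coe_iff] at hlast
  linarith

end GeometricDual

/-! ### Finite `ε`-solutions from outer approximations -/

section EpsClose

variable {n q m : ℕ} {A : Set (Vec q)} {V : Finset (Vec q)} {P : CVOP n q} {c w : Vec q} {ε : ℝ}

theorem IsVRepPoints.dot_le (hV : IsVRepPoints A V) (hw : w ∈ dualCone (recessionCone A)) {b : ℝ}
    (hb : ∀ v ∈ V, b ≤ dot w v) {y : Vec q} (hy : y ∈ A) : b ≤ dot w y := by
  obtain ⟨-, D, -, rfl⟩ := hV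
  obtain ⟨a, ha, d, hd, rfl⟩ := hy
  have hba : b ≤ dot w a := convexHull_min hb (convex_dot_ge w b) ha
  rw [dot_add]
  linarith [hw d (cone_subset_recessionCone_add _ _ hd)]

theorem IsVRepPoints.exists_le_dot (hV : IsVRepPoints A V)
    (hw : w ∈ dualCone (recessionCone A)) : ∃ b, ∀ y ∈ A, b ≤ dot w y := by
  obtain ⟨v₀, -, hv₀⟩ := V.exists_min_image (dot w) hV.1
  exact ⟨dot w v₀, fun y hy => hV.dot_le hw hv₀ hy⟩

/-- `v` is within `ε` of `Γ(X) + C` along the direction `c`, that is, `v + ε' c ∈ Γ(X) + C` for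
some `ε' ≤ ε`. In terms of the scalarization in direction `-c`, `ε' = -z`. -/
def CVOP.IsEpsClose (P : CVOP n q) (c : Vec q) (ε : ℝ) (v : Vec q) : Prop :=
  ∃ x z, P.P2Feasible v (-c) x z ∧ -z ≤ ε

theorem CVOP.IsEpsClose.sub_le_dot {v : Vec q} (hv : P.IsEpsClose c ε v) (hw : w ∈ dualCone P.C)
    (hcw : dot c w = 1) {β : ℝ} (hβ : ∀ x ∈ P.X, β ≤ dot w (P.Γ x)) : β - ε ≤ dot w v := by
  obtain ⟨x, z, hxz, hz⟩ := hv
  have hnonneg := hw _ hxz.2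
  rw [dot_sub, dot_add, dot_smul, dot_neg, dot_comm w c, hcw] at hnonneg
  linarith [hβ x hxz.1]

theorem IsVRepPoints.nonempty_X (hV : IsVRepPoints A V)
    (hclose : ∀ v ∈ V, P.IsEpsClose c ε v) : P.X.Nonempty := by
  obtain ⟨v, hv⟩ := hV.1
  obtain ⟨x, z, hx, -⟩ := hclose v hv
  exact ⟨x, hx.1⟩

/-- `W` is a finite set of supporting inequalities of `P`, and `B` is the set of the points
`Tᵀ w` for their normals `w`, as collected in `T̄` by the algorithm. -/
structure IsCutFamily (P : CVOP n q) (c : Vec q) (T : Matrix (Fin q) (Fin q) ℝ)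
    (W : Set (Vec q × ℝ)) (B : Set (Vec q)) : Prop where
  finite : W.Finite
  isSupport : ∀ h ∈ W, P.IsSupport c h
  image_eq : B = (fun h => tmul T h.1) '' W

end EpsClose

section EpsSolutions

variable {n m : ℕ} {P : CVOP n (m + 1)} {c : Vec (m + 1)}
  {T : Matrix (Fin (m + 1)) (Fin (m + 1)) ℝ} {W W' : Set (Vec (m + 1) × ℝ)}
  {B : Set (Vec (m + 1))} {V : Finset (Vec (m + 1))} {ε : ℝ}

theorem IsCutFamily.dualPoint_mem_convexHull (hW : IsCutFamily P c T W B) (hT : IsUnit T.det)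
    (hc : ∀ i, T i (Fin.last m) = c i) {h : Vec (m + 1) × ℝ} (hh : h ∈ convexHull ℝ W) :
    dualPoint T h ∈ convexHull ℝ (embed ⁻¹' (dualObjective P T '' B)) := by
  have hsub : dualPoint T '' W ⊆ embed ⁻¹' (dualObjective P T '' B) := by
    rintro _ ⟨h, hh, rfl⟩
    rw [hW.image_eq]
    exact ⟨_, Set.mem_image_of_mem _ hh, dualObjective_tmul hT hc (hW.isSupport h hh)⟩
  refine convexHull_mono hsub ?_
  rw [← LinearMap.image_convexHull]
  exact Set.mem_image_of_mem _ hh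

/-- For a feasible `t` the inequality `β - ε ≤ w(t)ᵀ y`, where `β` is the last entry of `D*(t)`, is
valid on the outer approximation, hence dominated by a convex combination of the inequalities that
define it. -/
theorem IsCutFamily.lowerImage_subset (hW' : IsCutFamily P c T W' B) (hT : IsUnit T.det)
    (hc : ∀ i, T i (Fin.last m) = c i) (hP : P.IsConvex) (hWW' : W ⊆ W')
    (hrec : recessionCone (polyhedron W) ⊆ P.C) (hV : IsVRepPoints (polyhedron W) V)
    (hclose : ∀ v ∈ V, P.IsEpsClose c ε v) :
    lowerImage P T ⊆ embed '' (convexHull ℝ (embed ⁻¹' (dualObjective P T '' B)) - coneK m +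
      {ε • lastUnit m}) := by
  rintro _ ⟨t, ht, k, hk, rfl⟩
  have hcw : dot c (weight T t) = 1 := dot_weight hT hc t
  have hwrec := dualCone_anti hrec ht
  have hsub : P.upperImage ⊆ polyhedron W :=
    CVOP.upperImage_subset_polyhedron fun h hh => hW'.isSupport h (hWW' hh)
  obtain ⟨x₀, hx₀⟩ := hV.nonempty_X hclose
  obtain ⟨b₀, hb₀⟩ := hV.exists_le_dot hwrec
  obtain ⟨β, hβ, hβle⟩ := exists_iInf_eq_coe ⟨x₀, hx₀⟩
    fun x hx => hb₀ _ (hsub (hP.mem_upperImage hx))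
  have hvalid : ∀ y ∈ polyhedron W, β - ε ≤ dot (weight T t) y := fun y hy =>
    hV.dot_le hwrec (fun v hv => (hclose v hv).sub_le_dot ht hcw hβle) hy
  obtain ⟨b, hb, hmem⟩ := exists_mem_convexHull_of_forall_polyhedron (hW'.finite.subset hWW')
    ⟨_, hsub (hP.mem_upperImage hx₀)⟩ (fun h hh => (hW'.isSupport h (hWW' hh)).norm) hcw hvalid
  have hdual := hW'.dualPoint_mem_convexHull hT hc (convexHull_mono hWW' hmem)
  have hlast : β - k ≤ dualPoint T (weight T t, b) (Fin.last m) + ε := by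
    rw [dualPoint_last]
    linarith
  simpa only [dualPoint_weight_castSucc hT, dualObjective, hβ, EReal.coe_sub]
    using mem_embed_image hdual hlast

theorem IsCutFamily.isFiniteDualEpsSolution (hW' : IsCutFamily P c T W' B) (hT : IsUnit T.det)
    (hc : ∀ i, T i (Fin.last m) = c i) (hP : P.IsConvex) (hWW' : W ⊆ W')
    (hrec : recessionCone (polyhedron W) ⊆ P.C) (hV : IsVRepPoints (polyhedron W) V)
    (hclose : ∀ v ∈ V, P.IsEpsClose c ε v) : IsFiniteDualEpsSolution P T ε B := by
  refine ⟨hW'.image_eq ▸ hW'.finite.image _, ?_, ?_,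
    hW'.lowerImage_subset hT hc hP hWW' hrec hV hclose⟩ <;> rw [hW'.image_eq]
  · rintro _ ⟨h, hh, rfl⟩
    exact tmul_mem_dualFeasible hT hc (hW'.isSupport h hh)
  · rintro _ ⟨h, hh, rfl⟩
    exact isKMaximal_dualObjective hT hc (hW'.isSupport h hh)

end EpsSolutions

/-! ### Invariants of the first phase -/

/-- Hoare's rule for loops over a list; the set `D` contains the elements that have been treated. -/
theorem ForEach.inv {α σ : Type} {step : α → σ → σ → Prop} {l : List α} {s s' : σ}
    {Inv : Set α → σ → Prop} (h : ForEach step l s s')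
    (hstep : ∀ D, ∀ a ∈ l, ∀ s s', step a s s' → Inv D s → Inv (insert a D) s') (hs : Inv ∅ s) :
    Inv {a | a ∈ l} s' := by
  suffices hgen : ∀ D, Inv D s → Inv ({a | a ∈ l} ∪ D) s' by
    simpa only [Set.union_empty] using hgen ∅ hs
  clear hs
  induction h with
  | nil s => simp
  | @cons a l s s₁ s₂ ha _ ih =>
    intro D hD
    have hrest := ih (fun D b hb => hstep D b (List.mem_cons_of_mem _ hb)) _
      (hstep D a List.mem_cons_self _ _ ha hD)
    convert hrest using 1
    ext b
    simp only [List.mem_cons, Set.mem_union, Set.mem_ofPred_eq, Set.mem_insert_iff]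
    tauto

section Cuts

variable {n q : ℕ} {P : CVOP n q} {c w : Vec q} {T : Matrix (Fin q) (Fin q) ℝ}
  {x : Fin n → ℝ} {W : Set (Vec q × ℝ)} {B Y : Set (Vec q)}

theorem IsCutFamily.insert (hW : IsCutFamily P c T W B) (hx : P.P1Optimal w x)
    (hw : w ∈ dualCone P.C) (hcw : 0 < dot c w) :
    IsCutFamily P c T (insert (P.supportingInequality c w x) W)
      (B ∪ {tmul T ((dot c w)⁻¹ • w)}) where
  finite := hW.finite.insert _
  isSupport := Set.forall_mem_insert.2
    ⟨CVOP.isSupport_supportingInequality hx hw hcw, hW.isSupport⟩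
  image_eq := by
    rw [Set.image_insert_eq, Set.union_singleton, hW.image_eq]
    rfl

theorem IsCutFamily.withCone (hW : IsCutFamily P c T W B)
    (hY : cone Y ⊆ dualCone (Prod.fst '' W)) : IsCutFamily (P.withCone Y) c T W B where
  finite := hW.finite
  isSupport h hh :=
    { norm := (hW.isSupport h hh).norm
      mem_dualCone := fun y hy => dot_comm y h.1 ▸ hY hy _ (Set.mem_image_of_mem _ hh)
      attained := (hW.isSupport h hh).attained
      le := (hW.isSupport h hh).le }
  image_eq := hW.image_eq

end Cuts

section PhaseOne

variable {n q : ℕ} {P : CVOP n q} {I : Input q} {δ : ℝ} {W : Set (Vec q × ℝ)} {s : State1 n q}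
  {d w : Vec q} {x : Fin n → ℝ}

/-- Invariant of the first phase: `P₀` is cut out by supporting inequalities `W` recorded in `T̄`,
`Y_In` consists of unit vectors in `𝒫_∞`, and the points of `Ĉ` are `δ`-close to `Y_In`. -/
structure PhaseOneInvariant (P : CVOP n q) (I : Input q) (δ : ℝ) (W : Set (Vec q × ℝ))
    (s : State1 n q) : Prop where
  isCutFamily : IsCutFamily P I.c I.T W s.Tbar
  P0_eq : s.P0 = polyhedron W
  YIn_subset : s.YIn ⊆ recessionCone P.upperImage
  norm_eq_one : ∀ r ∈ s.YIn, ‖r‖ = 1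
  exists_near : ∀ d ∈ s.Chat, ∃ r ∈ s.YIn, ‖d - r‖ ≤ δ

theorem PhaseOneInvariant.cut (hs : PhaseOneInvariant P I δ W s) (hx : P.P1Optimal w x)
    (hw : w ∈ dualCone P.C) (hcw : 0 < dot I.c w) {X : Set (Fin n → ℝ)} {Y : Set (Vec q)} :
    PhaseOneInvariant P I δ (insert (P.supportingInequality I.c w x) W)
      { s with
        Xbar := X
        YOut := Y
        Tbar := s.Tbar ∪ {tmul I.T ((dot I.c w)⁻¹ • w)}
        P0 := s.P0 ∩ halfspace w (P.Γ x) } where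
  isCutFamily := hs.isCutFamily.insert hx hw hcw
  P0_eq := by rw [hs.P0_eq, CVOP.polyhedron_insert_supportingInequality hcw]
  YIn_subset := hs.YIn_subset
  norm_eq_one := hs.norm_eq_one
  exists_near := hs.exists_near

theorem PhaseOneInvariant.insert_YIn (hs : PhaseOneInvariant P I δ W s)
    (hd : d ∈ recessionCone P.upperImage) (hnorm : ‖d‖ = 1) :
    PhaseOneInvariant P I δ W { s with YIn := s.YIn ∪ {d} } where
  isCutFamily := hs.isCutFamily
  P0_eq := hs.P0_eq
  YIn_subset := Set.union_subset hs.YIn_subset (Set.singleton_subset_iff.2 hd)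
  norm_eq_one := by
    rintro r (hr | rfl)
    · exact hs.norm_eq_one r hr
    · exact hnorm
  exists_near e he := by
    obtain ⟨r, hr, her⟩ := hs.exists_near e he
    exact ⟨r, Or.inl hr, her⟩

theorem PhaseOneInvariant.insert_Chat (hs : PhaseOneInvariant P I δ W s) {r : Vec q}
    (hr : r ∈ s.YIn) (hdr : ‖d - r‖ ≤ δ) :
    PhaseOneInvariant P I δ W { s with Chat := s.Chat ∪ {d} } where
  isCutFamily := hs.isCutFamily
  P0_eq := hs.P0_eq
  YIn_subset := hs.YIn_subset
  norm_eq_one := hs.norm_eq_one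
  exists_near := by
    rintro e (he | rfl)
    · exact hs.exists_near e he
    · exact ⟨r, hr, hdr⟩

end PhaseOne

section PhaseOneSteps

variable {n m : ℕ} {P : CVOP n (m + 1)} {I : Input (m + 1)} {δ : ℝ}
  {W : Set (Vec (m + 1) × ℝ)} {s s' : State1 n (m + 1)} {l : List (Vec (m + 1))}
  {x₀ : Fin n → ℝ}

theorem phaseOneInvariant_initState (hP : P.IsConvex) (hI : I.Valid P) :
    PhaseOneInvariant P I δ ∅ (initState I : State1 n (m + 1)) where
  isCutFamily :=
    { finite := Set.finite_empty
      isSupport := fun _ hh => hh.elim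
      image_eq := (Set.image_empty _).symm }
  P0_eq := polyhedron_empty.symm
  YIn_subset := (subset_cone _).trans (hI.R_generates ▸ hP.C_subset_recessionCone)
  norm_eq_one := hI.R_norm
  exists_near _ hd := hd.elim

theorem PhaseOneInvariant.forEach_boundednessStep (hI : I.Valid P) (hl : ∀ z ∈ l, z ∈ I.Rs)
    (h : ForEach (boundednessStep P I) l s s') (hs : PhaseOneInvariant P I δ W s) :
    ∃ W', PhaseOneInvariant P I δ W' s' ∧ (s'.b = true → {z | z ∈ l} ⊆ Prod.fst '' W') := by
  refine h.inv (Inv := fun D s => ∃ W', PhaseOneInvariant P I δ W' s ∧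
    (s.b = true → D ⊆ Prod.fst '' W')) ?_ ⟨W, hs, fun _ => Set.empty_subset _⟩
  rintro D z hz s s' (⟨-, rfl⟩ | ⟨x, hx, rfl⟩) ⟨W', hs, hD⟩
  · exact ⟨W', { hs with }, fun hb => absurd hb Bool.false_ne_true⟩
  · have hcz : dot I.c z = 1 := hI.Rs_norm z (hl z hz)
    have hzdual : z ∈ dualCone P.C := hI.Rs_generates ▸ subset_cone _ (hl z hz)
    have hcut := hs.cut hx hzdual (hcz ▸ one_pos) (X := s.Xbar ∪ {x}) (Y := s.YOut)
    rw [CVOP.supportingInequality, hcz, inv_one, one_smul] at hcut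
    refine ⟨_, hcut, fun hb => ?_⟩
    rw [Set.image_insert_eq]
    exact Set.insert_subset_insert (hD hb)

theorem PhaseOneInvariant.cut_of_optimal (hP : P.IsConvex) (hI : I.Valid P) (hx₀ : x₀ ∈ P.X)
    (hs : PhaseOneInvariant P I δ W s) {d w : Vec (m + 1)} {x : Fin n → ℝ} {z : ℝ}
    (hx : P.P2Optimal (P.Γ x₀ + ∑ r ∈ I.R, r) d x z)
    (hw : P.D2Optimal (P.Γ x₀ + ∑ r ∈ I.R, r) d w) {X : Set (Fin n → ℝ)}
    {Y : Set (Vec (m + 1))} :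
    PhaseOneInvariant P I δ (insert (P.supportingInequality I.c w x) W)
      { s with
        Xbar := X
        YOut := Y
        Tbar := s.Tbar ∪ {tmul I.T ((dot I.c w)⁻¹ • w)}
        P0 := s.P0 ∩ halfspace w (P.Γ x) } :=
  hs.cut (hP.p1Optimal_of_optimal
      (CVOP.p2Slater_add_sum hI.R_generates ⟨_, hI.c_interior⟩ hx₀ d) hx hw)
    hw.1.2 (hw.1.dot_pos hI.c_interior)

theorem PhaseOneInvariant.forEach_linealityStep (hP : P.IsConvex) (hI : I.Valid P)
    (hx₀ : x₀ ∈ P.X) (hl : ∀ d ∈ l, ‖d‖ = 1)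
    (h : ForEach (linealityStep P I (P.Γ x₀ + ∑ r ∈ I.R, r)) l s s')
    (hs : PhaseOneInvariant P I δ W s) : ∃ W', PhaseOneInvariant P I δ W' s' := by
  refine h.inv (Inv := fun _ s => ∃ W', PhaseOneInvariant P I δ W' s) ?_ ⟨W, hs⟩
  rintro - d hd s s' (⟨hunbounded, rfl⟩ | ⟨x, z, w, hx, hw, rfl⟩) ⟨W', hs⟩
  · exact ⟨W', hs.insert_YIn (hP.mem_recessionCone_of_P2Unbounded hunbounded) (hl d hd)⟩
  · exact ⟨_, hs.cut_of_optimal hP hI hx₀ hx hw⟩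

theorem PhaseOneInvariant.loopStep (hP : P.IsConvex) (hI : I.Valid P) (hx₀ : x₀ ∈ P.X)
    (h : loopStep P I δ (P.Γ x₀ + ∑ r ∈ I.R, r) s s') (hs : PhaseOneInvariant P I δ W s)
    (hY : s.YOut = outerDirections s.P0) :
    ∃ W', PhaseOneInvariant P I δ W' s' ∧ s'.YOut = outerDirections s'.P0 := by
  obtain ⟨d, -, r, hr, -, ⟨hdr, rfl⟩ | ⟨-, t, -, -, he, hstep⟩⟩ := h
  · exact ⟨W, hs.insert_Chat hr hdr, hY⟩
  · obtain ⟨hunbounded, rfl⟩ | ⟨x, z, w, hx, hw, rfl⟩ := hstep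
    · exact ⟨W, hs.insert_YIn (smul_mem_recessionCone
        (hP.mem_recessionCone_of_P2Unbounded hunbounded) (inv_nonneg.2 (norm_nonneg _)))
        (norm_smul_inv_norm he), hY⟩
    · exact ⟨_, hs.cut_of_optimal hP hI hx₀ hx hw, rfl⟩

theorem PhaseOneInvariant.reflTransGen_loopStep (hP : P.IsConvex) (hI : I.Valid P)
    (hx₀ : x₀ ∈ P.X)
    (h : Relation.ReflTransGen (CVO.loopStep P I δ (P.Γ x₀ + ∑ r ∈ I.R, r)) s s')
    (hs : PhaseOneInvariant P I δ W s) (hY : s.YOut = outerDirections s.P0) :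
    ∃ W', PhaseOneInvariant P I δ W' s' ∧ s'.YOut = outerDirections s'.P0 := by
  induction h with
  | refl => exact ⟨W, hs, hY⟩
  | tail _ hstep ih =>
    obtain ⟨W', hs', hY'⟩ := ih
    exact hs'.loopStep hP hI hx₀ hstep hY'

end PhaseOneSteps

/-! ### Result of the first phase -/

section OuterApproximation

theorem exists_norm_sub_le_of_mem_convexHull {E : Type*} [NormedAddCommGroup E] [NormedSpace ℝ E]
    {S K : Set E} {δ : ℝ} (hK : Convex ℝ K) (hS : ∀ d ∈ S, ∃ r ∈ K, ‖d - r‖ ≤ δ) {y : E}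
    (hy : y ∈ convexHull ℝ S) : ∃ r ∈ K, ‖y - r‖ ≤ δ := by
  have hsub : S ⊆ K + Metric.closedBall 0 δ := fun d hd => by
    obtain ⟨r, hr, hdr⟩ := hS d hd
    exact ⟨r, hr, d - r, mem_closedBall_zero_iff.2 hdr, add_sub_cancel _ _⟩
  obtain ⟨r, hr, e, he, rfl⟩ := convexHull_min hsub (hK.add (convex_closedBall 0 δ)) hy
  exact ⟨r, hr, by rwa [add_sub_cancel_left, ← mem_closedBall_zero_iff]⟩

variable {n q : ℕ} {P : CVOP n q} {I : Input q} {c : Vec q} {W : Set (Vec q × ℝ)} {δ : ℝ}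
  {s : State1 n q} {x : Fin n → ℝ}

theorem CVOP.IsConvex.isOuterApprox_outerDirections (hP : P.IsConvex) (hx : x ∈ P.X)
    (hW : W.Finite) (hsupport : ∀ h ∈ W, P.IsSupport c h) (hδ : 0 ≤ δ)
    (hnear : ∀ d ∈ outerDirections (polyhedron W),
      ∃ r ∈ recessionCone P.upperImage ∩ Metric.closedBall 0 1, ‖d - r‖ ≤ δ) :
    P.IsOuterApprox δ (outerDirections (polyhedron W)) := by
  have hne : (polyhedron W).Nonempty :=
    ⟨_, CVOP.upperImage_subset_polyhedron hsupport (hP.mem_upperImage hx)⟩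
  have hsub := hP.recessionCone_upperImage_subset hx hsupport
  rw [CVOP.IsOuterApprox, cone_outerDirections hW hne]
  refine ⟨hsub, Metric.hausdorffDist_le_of_mem_dist hδ
    (fun y hy => ⟨y, ⟨hsub hy.1, hy.2⟩, (dist_self y).trans_le hδ⟩) fun y hy => ?_⟩
  simp only [dist_eq_norm]
  rw [← convexHull_extremePoints_recessionCone hW hne] at hy
  refine exists_norm_sub_le_of_mem_convexHull
    ((convex_recessionCone _).inter (convex_closedBall 0 1)) (fun d hd => ?_) hy
  rcases eq_or_ne d 0 with rfl | hd0
  · refine ⟨0, ⟨hP.C_subset_recessionCone hP.zero_mem, Metric.mem_closedBall_self zero_le_one⟩, ?_⟩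
    rwa [sub_zero, norm_zero]
  · exact hnear d ⟨hd, hd0⟩

/-- What the first phase achieves: `P₀` is cut out by supporting inequalities `W` recorded in `T̄`,
and its recession cone is generated by the finite `δ`-outer approximation `Y_Out`. -/
structure IsPhaseOneResult (P : CVOP n q) (I : Input q) (δ : ℝ) (W : Set (Vec q × ℝ))
    (s : State1 n q) : Prop where
  isCutFamily : IsCutFamily P I.c I.T W s.Tbar
  P0_eq : s.P0 = polyhedron W
  cone_YOut : cone s.YOut = dualCone (Prod.fst '' W)
  finite_YOut : s.YOut.Finite
  isOuterApprox : P.IsOuterApprox δ s.YOut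

theorem PhaseOneInvariant.isPhaseOneResult_of_outerDirections (hP : P.IsConvex) (hδ : 0 ≤ δ)
    (hx : x ∈ P.X) (hs : PhaseOneInvariant P I δ W s) (hY : s.YOut = outerDirections s.P0)
    (hend : s.YOut ⊆ s.YIn ∪ s.Chat) : IsPhaseOneResult P I δ W s := by
  have hne : (polyhedron W).Nonempty :=
    ⟨_, CVOP.upperImage_subset_polyhedron hs.isCutFamily.isSupport (hP.mem_upperImage hx)⟩
  have hnear : ∀ d ∈ s.YOut,
      ∃ r ∈ recessionCone P.upperImage ∩ Metric.closedBall 0 1, ‖d - r‖ ≤ δ := fun d hd => by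
    obtain ⟨r, hr, hdr⟩ : ∃ r ∈ s.YIn, ‖d - r‖ ≤ δ := by
      rcases hend hd with hd | hd
      · exact ⟨d, hd, by rwa [sub_self, norm_zero]⟩
      · exact hs.exists_near d hd
    exact ⟨r, ⟨hs.YIn_subset hr, mem_closedBall_zero_iff.2 (hs.norm_eq_one r hr).le⟩, hdr⟩
  rw [hs.P0_eq] at hY
  refine ⟨hs.isCutFamily, hs.P0_eq, ?_, ?_, ?_⟩
  · rw [hY, cone_outerDirections hs.isCutFamily.finite hne, recessionCone_polyhedron hne]
  · exact hY ▸ (finite_extremePoints_recessionCone hs.isCutFamily.finite hne).subset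
      Set.sdiff_subset
  · rw [hY] at hnear ⊢
    exact hP.isOuterApprox_outerDirections hx hs.isCutFamily.finite hs.isCutFamily.isSupport hδ
      hnear

end OuterApproximation

section PhaseOneResult

variable {n m : ℕ} {P : CVOP n (m + 1)} {I : Input (m + 1)} {δ : ℝ}
  {W : Set (Vec (m + 1) × ℝ)} {s : State1 n (m + 1)} {x : Fin n → ℝ}

/-- If all weighted sum scalarizations are bounded, the normals of the inequalities generate `C⁺`,
so that `P₀` and the upper image have the recession cone `C`. -/
theorem PhaseOneInvariant.isPhaseOneResult_of_subset (hP : P.IsConvex) (hcl : IsClosed P.C)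
    (hI : I.Valid P) (hδ : 0 ≤ δ) (hx : x ∈ P.X) (hs : PhaseOneInvariant P I δ W s)
    (hRs : (I.Rs : Set (Vec (m + 1))) ⊆ Prod.fst '' W) :
    IsPhaseOneResult P I δ W { s with YOut := (I.R : Set (Vec (m + 1))) } := by
  have hne : (polyhedron W).Nonempty :=
    ⟨_, CVOP.upperImage_subset_polyhedron hs.isCutFamily.isSupport (hP.mem_upperImage hx)⟩
  have hsub := hP.recessionCone_upperImage_subset hx hs.isCutFamily.isSupport
  rw [recessionCone_polyhedron hne] at hsub
  have hdual : dualCone (Prod.fst '' W) ⊆ P.C :=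
    calc dualCone (Prod.fst '' W) ⊆ dualCone (I.Rs : Set (Vec (m + 1))) := dualCone_anti hRs
      _ = dualCone (dualCone P.C) := by rw [← dualCone_cone, hI.Rs_generates]
      _ = P.C := dualCone_dualCone hP.cone_C hcl
  have hrec : recessionCone P.upperImage = P.C :=
    (hsub.trans hdual).antisymm hP.C_subset_recessionCone
  refine ⟨hs.isCutFamily, hs.P0_eq, ?_, I.R.finite_toSet, ?_⟩
  · exact hI.R_generates.trans ((hrec ▸ hsub).antisymm hdual)
  · rw [CVOP.IsOuterApprox, hI.R_generates, hrec, Metric.hausdorffDist_self_zero]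
    exact ⟨subset_rfl, hδ⟩

theorem Phase1Terminates.exists_isPhaseOneResult (hP : P.IsConvex) (hcl : IsClosed P.C)
    (hI : I.Valid P) (hδ : 0 ≤ δ) (h : Phase1Terminates P I δ s) :
    ∃ W, IsPhaseOneResult P I δ W s := by
  obtain ⟨x₀, hx₀, lz, hlz, s₃, hbounded, hcase⟩ := h
  obtain ⟨W₃, hs₃, hRs⟩ := (phaseOneInvariant_initState hP hI).forEach_boundednessStep
    (δ := δ) hI (fun z hz => (hlz.2 z).1 hz) hbounded
  obtain ⟨hb, rfl⟩ | ⟨-, lr, hlr, s₅, hlineality, hloop, hend⟩ := hcase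
  · exact ⟨W₃, hs₃.isPhaseOneResult_of_subset hP hcl hI hδ hx₀
      fun z hz => hRs hb ((hlz.2 z).2 hz)⟩
  · have hnorm : ∀ d ∈ lr.map (fun r => -r), ‖d‖ = 1 := by
      simp only [List.mem_map, forall_exists_index, and_imp, forall_apply_eq_imp_iff₂, norm_neg]
      exact fun r hr => hI.R_norm r ((hlr.2 r).1 hr)
    obtain ⟨W₅, hs₅⟩ := hs₃.forEach_linealityStep hP hI hx₀ hnorm hlineality
    obtain ⟨W, hs, hY⟩ := PhaseOneInvariant.reflTransGen_loopStep hP hI hx₀ hloop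
      { hs₅ with } rfl
    exact ⟨W, hs.isPhaseOneResult_of_outerDirections hP hδ hx₀ hY (Set.sdiff_eq_empty.1 hend)⟩

end PhaseOneResult

/-! ### Invariants of the second phase -/

section PhaseTwo

variable {n q : ℕ} {P : CVOP n q} {I : Input q} {ε : ℝ} {W₀ : Set (Vec q × ℝ)}
  {A B : Set (Vec q)} {s s' : State2 n q} {v w : Vec q} {x : Fin n → ℝ} {z : ℝ}

/-- `A` is an outer approximation of the upper image that is cut out by supporting inequalities `W`
recorded in `B`, among them those in `W₀`. The recorded inequalities `W'` need not all be used. -/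
def IsOuterCut (P : CVOP n q) (I : Input q) (W₀ : Set (Vec q × ℝ)) (A B : Set (Vec q)) : Prop :=
  ∃ W W', W₀ ⊆ W ∧ W ⊆ W' ∧ IsCutFamily P I.c I.T W' B ∧ A = polyhedron W

theorem IsOuterCut.record (h : IsOuterCut P I W₀ A B) (hx : P.P1Optimal w x)
    (hw : w ∈ dualCone P.C) (hcw : dot I.c w = 1) :
    IsOuterCut P I W₀ A (B ∪ {tmul I.T w}) := by
  obtain ⟨W, W', hW₀, hWW', hW', hA⟩ := h
  have hinsert := hW'.insert hx hw (hcw ▸ one_pos)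
  rw [hcw, inv_one, one_smul] at hinsert
  exact ⟨W, _, hW₀, hWW'.trans (Set.subset_insert _ _), hinsert, hA⟩

theorem IsOuterCut.cut (h : IsOuterCut P I W₀ A B) (hx : P.P1Optimal w x)
    (hw : w ∈ dualCone P.C) (hcw : dot I.c w = 1) :
    IsOuterCut P I W₀ (A ∩ halfspace w (P.Γ x)) (B ∪ {tmul I.T w}) := by
  obtain ⟨W, W', hW₀, hWW', hW', rfl⟩ := h
  have hpos : 0 < dot I.c w := hcw ▸ one_pos
  have hinsert := hW'.insert hx hw hpos
  rw [← CVOP.polyhedron_insert_supportingInequality hpos]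
  rw [hcw, inv_one, one_smul] at hinsert
  exact ⟨_, _, hW₀.trans (Set.subset_insert _ _), Set.insert_subset_insert hWW', hinsert, rfl⟩

/-- Invariant of the loop over the points of a V-representation of the current approximation
`A`, where the points in `D` have been treated. -/
structure VertexInvariant (P : CVOP n q) (I : Input q) (ε : ℝ) (W₀ : Set (Vec q × ℝ))
    (A D : Set (Vec q)) (s : State2 n q) : Prop where
  Pk_eq : s.Pk = A
  isOuterCut : IsOuterCut P I W₀ (A ∩ s.M) s.Tbar
  isEpsClose : s.M = Set.univ → ∀ v ∈ D, P.IsEpsClose I.c ε v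

theorem VertexInvariant.vertexStep (hP : P.IsConvex) (hc : I.c ∈ interior P.C) {D : Set (Vec q)}
    (h : vertexStep P I ε v s s') (hs : VertexInvariant P I ε W₀ A D s) :
    VertexInvariant P I ε W₀ A (insert v D) s' := by
  obtain ⟨x, z, w, hx, hw, hcase⟩ := h
  have hx₁ : P.P1Optimal w x :=
    hP.p1Optimal_of_optimal (hP.p2Slater_neg ⟨x, hx.1.1⟩ hc v) hx hw
  have hcw : dot I.c w = 1 := by
    rw [← neg_inj, dot_comm, ← dot_neg, hw.1.1]
  obtain ⟨-, rfl⟩ | ⟨hz, rfl⟩ := hcase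
  · refine ⟨hs.Pk_eq, ?_, fun hM : s.M ∩ _ = Set.univ => ?_⟩
    · rw [← Set.inter_assoc]
      exact hs.isOuterCut.cut hx₁ hw.1.2 hcw
    · have hw0 : w ≠ 0 := by
        rintro rfl
        exact one_ne_zero (hcw.symm.trans (dot_zero _))
      exact absurd (Set.univ_subset_iff.1 (hM.ge.trans Set.inter_subset_right))
        (halfspace_ne_univ hw0 _)
  · exact ⟨hs.Pk_eq, hs.isOuterCut.record hx₁ hw.1.2 hcw, fun hM =>
      Set.forall_mem_insert.2 ⟨⟨x, z, hx.1, hz⟩, hs.isEpsClose hM⟩⟩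

/-- Invariant of the second phase, started with the inequalities `W₀`: when the loop has stopped,
the points of some V-representation of the current approximation are `ε`-close. -/
structure PhaseTwoInvariant (P : CVOP n q) (I : Input q) (ε : ℝ) (W₀ : Set (Vec q × ℝ))
    (s : State2 n q) : Prop where
  isOuterCut : IsOuterCut P I W₀ s.Pk s.Tbar
  isEpsClose : s.M = Set.univ → ∃ V, IsVRepPoints s.Pk V ∧ ∀ v ∈ V, P.IsEpsClose I.c ε v

theorem PhaseTwoInvariant.outerStep (hP : P.IsConvex) (hc : I.c ∈ interior P.C)
    (h : outerStep P I ε s s') (hs : PhaseTwoInvariant P I ε W₀ s) :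
    PhaseTwoInvariant P I ε W₀ s' := by
  obtain ⟨-, V, hV, l, hl, s₁, hvertices, hcase⟩ := h
  have hinit : VertexInvariant P I ε W₀ s.Pk ∅ { s with M := Set.univ } :=
    ⟨rfl, (Set.inter_univ s.Pk).symm ▸ hs.isOuterCut, fun _ _ hv => hv.elim⟩
  have hs₁ := hvertices.inv (Inv := VertexInvariant P I ε W₀ s.Pk)
    (fun _ _ _ _ _ => VertexInvariant.vertexStep hP hc) hinit
  have hcut := hs₁.isOuterCut
  rw [← hs₁.Pk_eq] at hcut hV
  obtain ⟨hM, rfl⟩ | ⟨hM, rfl⟩ := hcase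
  · exact ⟨hcut, fun hM' => absurd hM' hM⟩
  · rw [hM, Set.inter_univ] at hcut
    exact ⟨hcut, fun _ => ⟨V, hV, fun v hv => hs₁.isEpsClose hM v ((hl.2 v).2 hv)⟩⟩

theorem PhaseTwoInvariant.reflTransGen_outerStep (hP : P.IsConvex) (hc : I.c ∈ interior P.C)
    (h : Relation.ReflTransGen (CVO.outerStep P I ε) s s')
    (hs : PhaseTwoInvariant P I ε W₀ s) : PhaseTwoInvariant P I ε W₀ s' := by
  induction h with
  | refl => exact hs
  | tail _ hstep ih => exact ih.outerStep hP hc hstep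

end PhaseTwo

section PhaseTwoResult

variable {n m : ℕ} {P : CVOP n (m + 1)} {I : Input (m + 1)} {ε : ℝ}
  {W₀ : Set (Vec (m + 1) × ℝ)} {s : State2 n (m + 1)}

theorem PhaseTwoInvariant.isFiniteDualEpsSolution (hP : P.IsConvex) (hT : IsUnit I.T.det)
    (hc : ∀ i, I.T i (Fin.last m) = I.c i) (hW₀ : dualCone (Prod.fst '' W₀) ⊆ P.C)
    (hs : PhaseTwoInvariant P I ε W₀ s) (hM : s.M = Set.univ) :
    IsFiniteDualEpsSolution P I.T ε s.Tbar := by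
  obtain ⟨W, W', hW₀W, hWW', hW', hPk⟩ := hs.isOuterCut
  obtain ⟨V, hV, hclose⟩ := hs.isEpsClose hM
  obtain ⟨x, hx⟩ := hV.nonempty_X hclose
  rw [hPk] at hV
  have hne : (polyhedron W).Nonempty := ⟨_, CVOP.upperImage_subset_polyhedron
    (fun h hh => hW'.isSupport h (hWW' hh)) (hP.mem_upperImage hx)⟩
  have hrec : recessionCone (polyhedron W) ⊆ P.C := by
    rw [recessionCone_polyhedron hne]
    exact (dualCone_anti (Set.image_mono hW₀W)).trans hW₀
  exact hW'.isFiniteDualEpsSolution hT hc hP hWW' hrec hV hclose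

end PhaseTwoResult

end CVO

theorem mainTheorem3_general {n m : ℕ} (P : CVO.CVOP n (m + 1)) (hP : P.IsConvex)
    (hcl : IsClosed P.C) (I : CVO.Input (m + 1)) (hI : I.Valid P) (ε δ : ℝ) (hδ : 0 ≤ δ)
    (Xbar : Set (Fin n → ℝ)) (YOut Tbar : Set (CVO.Vec (m + 1)))
    (hrun : CVO.PrimalAlgorithmTerminates P I ε δ Xbar YOut Tbar) :
    CVO.IsFiniteDualSolution P I.T ε δ Tbar YOut := by
  obtain ⟨s, out, hphase1, hphase2, hM, -, rfl, rfl⟩ := hrun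
  obtain ⟨W₀, hs⟩ := hphase1.exists_isPhaseOneResult hP hcl hI hδ
  have hC : P.C ⊆ CVO.cone s.YOut := hP.C_subset_recessionCone.trans hs.isOuterApprox.1
  have hP' : (P.withCone s.YOut).IsConvex := hP.withCone hC
  have hstart : CVO.PhaseTwoInvariant (P.withCone s.YOut) I ε W₀
      { Pk := s.P0, Xbar := s.Xbar, Tbar := s.Tbar, M := ∅ } :=
    ⟨⟨W₀, W₀, subset_rfl, subset_rfl, hs.isCutFamily.withCone hs.cone_YOut.le, hs.P0_eq⟩,
      fun h => absurd h Set.empty_ne_univ⟩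
  have hout := hstart.reflTransGen_outerStep hP' (interior_mono hC hI.c_interior) hphase2
  exact ⟨hs.finite_YOut, hs.isOuterApprox,
    hout.isFiniteDualEpsSolution hP' hI.T_nonsingular hI.T_last hs.cone_YOut.ge hM⟩

theorem mainTheorem3 {n m : ℕ} (P : CVO.CVOP n (m + 1)) (hP : P.StandingAssumption)
    (I : CVO.Input (m + 1)) (hI : I.Valid P) (ε δ : ℝ) (hε : 0 < ε) (hδ : 0 < δ)
    (Xbar : Set (Fin n → ℝ)) (YOut Tbar : Set (CVO.Vec (m + 1)))
    (hrun : CVO.PrimalAlgorithmTerminates P I ε δ Xbar YOut Tbar) :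
    CVO.IsFiniteDualSolution P I.T ε δ Tbar YOut :=
  mainTheorem3_general P hP.isConvex hP.C_closed I hI ε δ hδ.le Xbar YOut Tbar hrun
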